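/- \textbf{Setting.} Let $d\ge 1$ and let $\Omega\subset\mathbb R^d$ be a bounded open polyhedron (its boundary lies in finitely many hyperplanes). For $\delta>0$ put $\Omega_\delta^c=\{y\notin\Omega:\operatorname{dist}(y,\partial\Omega)<\delta\}$ and $\widehat\Omega_\delta=\Omega\cup\Omega_\delta^c$. A function is in $C_b^n(D)$, $D$ open, if it is $C^n$ on $D$ with bounded derivatives of order $\le n$. For a kernel $\gamma_\delta$ let $$\mathcal L_\delta u(x)=2\int_{\mathbb R^d}(u(y)-u(x))\gamma_\delta(x,y)\,dy,\qquad \|u\|_\delta^2=\int_{\widehat\Omega_\delta}\int_{\widehat\Omega_\delta}(u(y)-u(x))^2\gamma_\delta(x,y)\,dy\,dx .$$ \textbf{Hypotheses.} Let $u_0\in C_b^4(\Omega)$ solve $-\Delta u_0=f_0$ in $\Omega$, $u_0=g_0$ on $\partial\Omega$. Let $\delta_0>0$ and let $\widetilde u_0\in C_b^4(\widehat\Omega_{\delta_0})$ satisfy $\widetilde u_0=u_0$ on $\Omega$. For every $0<\delta\le\delta_0$ let $\gamma_\delta:\mathbb R^d\times\mathbb R^d\to[0,\infty)$ be symmetric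 and radial, $\gamma_\delta(x,y)=\widetilde\gamma_\delta(|y-x|)$, with $\gamma_\delta(x,y)=0$ for $x\in\Omega$ and $|y-x|\ge\delta$, $\widetilde\gamma_\delta>0$ on $(0,\delta)$, $\widetilde\gamma_\delta\in L^1(0,\delta)$, $w_d\int_0^\delta s^{d+1}\widetilde\gamma_\delta(s)\,ds=d$ ($w_d$ the surface area of the unit sphere), and $$\sup_{x\in\widehat\Omega_\delta}\int_{B_\delta(x)\cap\widehat\Omega_\delta}\gamma_\delta(x,y)\,dy\le C_G\,\delta^{-2}.$$ Let $\mu\in\{0,1\}$ and let $f_\delta$ (measurable on $\Omega$) and $g_\delta$ satisfy $\sup_\Omega|f_\delta-f_0|\le C_f\delta^2$ and $\sup_{\Omega_\delta^c}|g_\delta-\widetilde u_0|\le C_g\delta^{2+\mu}$ for $0<\delta\le\delta_0$, with $C_G,C_f,C_g$ independent of $\delta$. Let $C_h$ be a constant. \textbf{Nonlocal solution.} $u_\delta\in L^2(\widehat\Omega_\delta)$ with $\|u_\delta\|_\delta<\infty$, $u_\delta=g_\delta$ on $\Omega_\delta^c$, and $-\int_\Omega w\,\mathcal L_\delta u_\delta=\int_\Omega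 f_\delta w$ for all $w\in L^2(\widehat\Omega_\delta)$ with $\|w\|_\delta<\infty$ and $w=0$ on $\Omega_\delta^c$. \textbf{CDG solution.} Take finite conforming simplicial meshes, with elements of diameter at most $h$, of $\overline\Omega$ (filled exactly) and of $\Omega_\delta^c$ (covered by elements lying outside $\Omega$). Let $V_\delta^{0,h}$ (resp. $V_\delta^{c,h}$) be the continuous piecewise linear functions on the first (resp. second) mesh, restricted to $\Omega$ (resp. $\Omega_\delta^c$) and extended by zero. Let $g_\delta^h\in V_\delta^{c,h}$ be an approximation of $g_\delta$ with $\sup_{\Omega_\delta^c}|g_\delta-g_\delta^h|\le C_h h^2$. Then $u_\delta^h=u_\delta^{0,h}+g_\delta^h$, where $u_\delta^{0,h}\in V_\delta^{0,h}$ satisfies, for all $w_h\in V_\delta^{0,h}$, $$-2\int_\Omega w_h(x)\int_{B_\delta(x)\cap\Omega}(u_\delta^{0,h}(y)-u_\delta^{0,h}(x))\gamma_\delta(x,y)\,dy\,dx=\int_\Omega f_\delta w_h+2\int_\Omega w_h(x)\int_{B_\delta(x)\cap\Omega_\delta^c}(g_\delta^h(y)-u_\delta^{0,h}(x))\gamma_\delta(x,y)\,dy\,dx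 .$$ \textbf{Theorem.} There is a constant $C>0$, independent of $\delta$, $h$, the meshes and $g_\delta^h$, such that for all $0<\delta\le\delta_0$, all $h>0$, and all meshes, $g_\delta^h$, $u_\delta$ and $u_\delta^h$ as above, $$\|u_\delta-u_\delta^h\|_\delta\le C\big(\delta^{(3+\mu)/2}+\delta^{-1}h^2\big),\qquad \|u_\delta-u_\delta^h\|_{L^2(\Omega)}\le C\big(\delta^{(3+\mu)/2}+\delta^{-1}h^2\big).$$ -/

import Mathlib

open MeasureTheory Set Filter Topology
open scoped ENNReal

namespace NonlocalCDG

/-- Euclidean space `ℝ^d`. -/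
abbrev Eu (d : ℕ) : Type := EuclideanSpace ℝ (Fin d)

/-- A bounded open polyhedron: a bounded open set whose boundary lies in the union of finitely many
hyperplanes `{x | ⟪a, x⟫ = b}`, `a ≠ 0`. -/
def IsBoundedOpenPolyhedron {d : ℕ} (Ω : Set (Eu d)) : Prop :=
  IsOpen Ω ∧ Bornology.IsBounded Ω ∧
    ∃ H : Finset (Eu d × ℝ), (∀ p ∈ H, p.1 ≠ 0) ∧
      frontier Ω ⊆ ⋃ p ∈ H, {x | inner ℝ p.1 x = p.2}

/-- The interaction domain `Ω_δ^c = {y ∉ Ω : dist(y, ∂Ω) < δ}`. -/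
def interactionDomain {d : ℕ} (Ω : Set (Eu d)) (δ : ℝ) : Set (Eu d) :=
  {y | y ∉ Ω ∧ y ∈ Metric.thickening δ (frontier Ω)}

/-- `Ω̂_δ = Ω ∪ Ω_δ^c`. -/
def extendedDomain {d : ℕ} (Ω : Set (Eu d)) (δ : ℝ) : Set (Eu d) :=
  Ω ∪ interactionDomain Ω δ

/-- `u ∈ C_b^n(D)` for an open set `D`: `u` is `C^n` on `D` and its derivatives of order `≤ n`
are bounded on `D`. -/
def IsCb {d : ℕ} (n : ℕ) (D : Set (Eu d)) (u : Eu d → ℝ) : Prop :=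
  ContDiffOn ℝ n u D ∧
    ∀ j ≤ n, ∃ M : ℝ, ∀ x ∈ D, ‖iteratedFDerivWithin ℝ j u D x‖ ≤ M

/-- `u₀ ∈ C_b^4(Ω)` solves `-Δ u₀ = f₀` in `Ω`, `u₀ = g₀` on `∂Ω`
(the boundary values are the limits of `u₀` from inside `Ω`). -/
structure SolvesLocalProblem {d : ℕ} (Ω : Set (Eu d)) (f₀ g₀ u₀ : Eu d → ℝ) : Prop where
  regular : IsCb 4 Ω u₀
  equation : ∀ x ∈ Ω, -(Laplacian.laplacian u₀ x) = f₀ x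
  boundary : ∀ x ∈ frontier Ω, Tendsto u₀ (𝓝[Ω] x) (𝓝 (g₀ x))

/-- The standing conditions on the kernel `γ_δ`: nonnegative, symmetric, vanishing for `x ∈ Ω`,
`y ∉ B_δ(x)`, and radial, `γ_δ(x, y) = ρ(|y - x|)`, with a profile `ρ` that is positive
and integrable on `(0, δ)` and normalised by `w_d ∫₀^δ s^{d+1} ρ(s) ds = d`, where `w_d` is the
surface area of the unit sphere of `ℝ^d`. -/
structure IsKernel {d : ℕ} (Ω : Set (Eu d)) (δ : ℝ) (γ : Eu d → Eu d → ℝ) : Prop where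
  nonneg : ∀ x y, 0 ≤ γ x y
  symm : ∀ x y, γ x y = γ y x
  finite_range : ∀ x ∈ Ω, ∀ y, y ∉ Metric.ball x δ → γ x y = 0
  radial : ∃ ρ : ℝ → ℝ,
    (∀ x y, γ x y = ρ ‖y - x‖) ∧
    (∀ s ∈ Ioo 0 δ, 0 < ρ s) ∧
    IntegrableOn ρ (Ioo 0 δ) ∧
    (volume : Measure (Eu d)).toSphere.real univ * ∫ s in Ioo 0 δ, s ^ (d + 1) * ρ s = d

/-- `G(γ_δ) = sup_{x ∈ Ω̂_δ} ∫_{B_δ(x) ∩ Ω̂_δ} γ_δ(x, y) dy`. -/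
noncomputable def kernelMass {d : ℕ} (Ω : Set (Eu d)) (δ : ℝ) (γ : Eu d → Eu d → ℝ) : ℝ≥0∞ :=
  ⨆ x ∈ extendedDomain Ω δ, ∫⁻ y in Metric.ball x δ ∩ extendedDomain Ω δ, ENNReal.ofReal (γ x y)

/-- The nonlocal operator `L_δ u(x) = 2 ∫ (u(y) - u(x)) γ_δ(x, y) dy`. -/
noncomputable def nonlocalOp {d : ℕ} (γ : Eu d → Eu d → ℝ) (u : Eu d → ℝ) (x : Eu d) : ℝ :=
  2 * ∫ y, (u y - u x) * γ x y

/-- The nonlocal energy norm `‖u‖_δ`, with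
`‖u‖_δ² = ∫_{Ω̂_δ} ∫_{Ω̂_δ} (u(y) - u(x))² γ_δ(x, y) dy dx`, as an element of `[0, ∞]`. -/
noncomputable def energyNorm {d : ℕ} (Ω : Set (Eu d)) (δ : ℝ) (γ : Eu d → Eu d → ℝ)
    (u : Eu d → ℝ) : ℝ≥0∞ :=
  (∫⁻ x in extendedDomain Ω δ, ∫⁻ y in extendedDomain Ω δ,
    ENNReal.ofReal ((u y - u x) ^ 2 * γ x y)) ^ (1 / 2 : ℝ)

/-- The constrained energy space: `u ∈ L²(Ω̂_δ)`, `‖u‖_δ < ∞`, and `u = g` (almost everywhere)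
on `Ω_δ^c`. With `g = 0` it is `V⁰(Ω̂_δ)`. -/
structure MemV {d : ℕ} (Ω : Set (Eu d)) (δ : ℝ) (γ : Eu d → Eu d → ℝ) (g : Eu d → ℝ)
    (u : Eu d → ℝ) : Prop where
  memLp : MemLp u 2 (volume.restrict (extendedDomain Ω δ))
  energy : energyNorm Ω δ γ u < ∞
  constraint : ∀ᵐ x ∂(volume.restrict (interactionDomain Ω δ)), u x = g x

/-- The variational nonlocal problem: `u ∈ V(Ω̂_δ)`, `u = g` on `Ω_δ^c`, and
`-∫_Ω w L_δ u = ∫_Ω f w` for all `w ∈ V⁰(Ω̂_δ)`. -/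
def SolvesNonlocal {d : ℕ} (Ω : Set (Eu d)) (δ : ℝ) (γ : Eu d → Eu d → ℝ)
    (f g u : Eu d → ℝ) : Prop :=
  MemV Ω δ γ g u ∧
    ∀ w : Eu d → ℝ, MemV Ω δ γ (fun _ => 0) w →
      -(∫ x in Ω, w x * nonlocalOp γ u x) = ∫ x in Ω, f x * w x

/-- A finite conforming simplicial mesh all of whose elements have diameter at most `h`. -/
structure IsMesh {d : ℕ} (K : Geometry.SimplicialComplex ℝ (Eu d)) (h : ℝ) : Prop where
  finite : K.faces.Finite
  diam_le : ∀ s ∈ K.faces, Metric.diam (convexHull ℝ (s : Set (Eu d))) ≤ h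

/-- A mesh of size at most `h` of `Ω`; its elements fill `closure Ω` exactly. -/
structure IsMeshOfDomain {d : ℕ} (Ω : Set (Eu d))
    (K : Geometry.SimplicialComplex ℝ (Eu d)) (h : ℝ) : Prop extends IsMesh K h where
  space_eq : K.space = closure Ω

/-- A mesh of size at most `h` of `Ω_δ^c`. Since `Ω_δ^c` has rounded corners, straight elements
cannot fill it exactly: they lie outside `Ω` and cover `Ω_δ^c`. -/
structure IsMeshOfInteraction {d : ℕ} (Ω : Set (Eu d)) (δ : ℝ)
    (K : Geometry.SimplicialComplex ℝ (Eu d)) (h : ℝ) : Prop extends IsMesh K h where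
  covers : interactionDomain Ω δ ⊆ K.space
  outside : Disjoint K.space Ω

/-- Continuous functions on the mesh that are affine on each element. -/
structure IsPiecewiseLinear {d : ℕ} (K : Geometry.SimplicialComplex ℝ (Eu d))
    (p : Eu d → ℝ) : Prop where
  continuousOn : ContinuousOn p K.space
  affine : ∀ s ∈ K.faces, ∃ A : Eu d →ᵃ[ℝ] ℝ, EqOn p A (convexHull ℝ (s : Set (Eu d)))

/-- `V_δ^{0,h}`: continuous piecewise linear functions on `Ω`, extended by zero. -/
def discreteV0 {d : ℕ} (Ω : Set (Eu d)) (K : Geometry.SimplicialComplex ℝ (Eu d)) :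
    Set (Eu d → ℝ) :=
  {v | ∃ p, IsPiecewiseLinear K p ∧ v = Ω.indicator p}

/-- `V_δ^{c,h}`: continuous piecewise linear functions on `Ω_δ^c`, extended by zero. -/
def discreteVc {d : ℕ} (Ω : Set (Eu d)) (δ : ℝ) (K : Geometry.SimplicialComplex ℝ (Eu d)) :
    Set (Eu d → ℝ) :=
  {v | ∃ p, IsPiecewiseLinear K p ∧ v = (interactionDomain Ω δ).indicator p}

/-- `u = u^{0,h} + g^h` is the linear conforming discontinuous Galerkin (CDG) approximation with
discrete volume constraint `g^h`, on the mesh `K` of `Ω`. -/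
def IsCDGSolution {d : ℕ} (Ω : Set (Eu d)) (δ : ℝ) (γ : Eu d → Eu d → ℝ)
    (K : Geometry.SimplicialComplex ℝ (Eu d)) (f gh uh : Eu d → ℝ) : Prop :=
  ∃ u0h ∈ discreteV0 Ω K,
    (∀ w ∈ discreteV0 Ω K,
      -2 * ∫ x in Ω, w x * ∫ y in Metric.ball x δ ∩ Ω, (u0h y - u0h x) * γ x y
        = (∫ x in Ω, f x * w x)
          + 2 * ∫ x in Ω, w x * ∫ y in Metric.ball x δ ∩ interactionDomain Ω δ,
              (gh y - u0h x) * γ x y) ∧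
    uh = fun x => u0h x + gh x

end NonlocalCDG

/-! Let E be the extended domain and let k(z) be the radial kernel, so that `γ x y = k (y - x)`. The
energy norm of u is the L² norm of the increment u(y) - u(x) for the measure k(y - x) dy dx on E ×
E. As k is even, swapping x and y gives a Green identity (`nonlocal_green`), so the nonlocal problem
and the CDG scheme are both variational problems for this one inner product, and their difference is
orthogonal to discrete test functions.

Three estimates are uniform in δ. (1) Consistency, `abs_integral_sub_laplacian_le`: odd Taylor terms
cancel, the second moments of k are normalised, and the operator differs from the Laplacian by O(δ²)
on the extension of the local solution. (2) `nonlocal_poincare`: the L² norm of a function vanishing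
off Ω is at most a constant times its energy norm. (3) `eLpNorm_increment_le`: conversely, the
energy norm is at most 2√(∫k) = O(δ⁻¹) times the L² norm.

The exact solution u is compared only with the extension v of the local solution; no smoothness of u
is used. Testing with e = u - v cut off to Ω bounds its energy by the O(δ²) residual, through (2),
plus the energy of u - v cut off to the interaction domain (`SolvesNonlocal.norm_sub_le`). That
strip has volume O(δ), because the boundary lies in finitely many hyperplanes, so by (3) the last
term is O(δ⁻¹ · δ^(1/2) · δ^(2+μ)). Both contributions are O(δ^((3+μ)/2)).

For the discrete error (`cdg_error_le`) write u - uh = e - q + w. Here q = O(h²) pointwise collects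
the interpolation error of v and the error of the discrete constraint, and w is a discrete test
function. Pythagoras bounds the energies of u - uh and of w by those of e and q; by (3) q
contributes O(δ⁻¹h²). The L² estimate follows by applying (2) to e and w, which vanish off Ω, and
the pointwise bound to q. -/

namespace NonlocalCDG

/-! ### The energy norm as an L² norm of increments -/

variable {d : ℕ} {E : Set (Eu d)} {k : Eu d → ℝ}

/-- The measure `k(y - x) dy dx` on `E × E`. -/
noncomputable def pairMeasure (E : Set (Eu d)) (k : Eu d → ℝ) : Measure (Eu d × Eu d) :=
  ((volume.restrict E).prod (volume.restrict E)).withDensity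
    fun p => ENNReal.ofReal (k (p.2 - p.1))

/-- The increment `u(y) - u(x)` of a function, as a function of the pair `(x, y)`. -/
def increment (u : Eu d → ℝ) (p : Eu d × Eu d) : ℝ := u p.2 - u p.1

/-- The kernel is only a.e. measurable, so what is needed is that subtraction pulls null sets back
to null sets of the product. -/
lemma aemeasurable_kernel_prod (hk : AEMeasurable k) :
    AEMeasurable (fun p : Eu d × Eu d => k (p.2 - p.1))
      (volume.prod volume) := by
  have h := (quasiMeasurePreserving_sub (volume : Measure (Eu d)) (volume : Measure (Eu d))).comp
    (Measure.measurePreserving_swap (μ := (volume : Measure (Eu d)))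
      (ν := (volume : Measure (Eu d)))).quasiMeasurePreserving
  exact hk.comp_quasiMeasurePreserving h

lemma aemeasurable_kernel (hk : AEMeasurable k) (E : Set (Eu d)) :
    AEMeasurable (fun p : Eu d × Eu d => k (p.2 - p.1))
      ((volume.restrict E).prod (volume.restrict E)) := by
  rw [Measure.prod_restrict]
  exact (aemeasurable_kernel_prod hk).restrict

lemma pairMeasure_absolutelyContinuous (E : Set (Eu d)) (k : Eu d → ℝ) :
    pairMeasure E k ≪ (volume.restrict E).prod (volume.restrict E) :=
  withDensity_absolutelyContinuous _ _

lemma lintegral_pairMeasure (hk : AEMeasurable k) {F : Eu d × Eu d → ℝ≥0∞}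
    (hF : AEMeasurable F ((volume.restrict E).prod (volume.restrict E))) :
    ∫⁻ p, F p ∂(pairMeasure E k)
      = ∫⁻ x in E, ∫⁻ y in E, ENNReal.ofReal (k (y - x)) * F (x, y) := by
  have hk' := (aemeasurable_kernel hk E).ennreal_ofReal
  rw [pairMeasure, lintegral_withDensity_eq_lintegral_mul₀ hk' hF, lintegral_prod _ (hk'.mul hF)]
  rfl

lemma setLIntegral_kernel_le (E : Set (Eu d)) (x : Eu d) :
    ∫⁻ y in E, ENNReal.ofReal (k (y - x)) ≤ ∫⁻ z, ENNReal.ofReal (k z) := by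
  refine (setLIntegral_le_lintegral _ _).trans ?_
  rw [lintegral_sub_right_eq_self (fun z => ENNReal.ofReal (k z)) x]

/-- The first marginal has density x ↦ ∫_E k(y - x) dy on E, and by translation invariance this
never exceeds the total mass of k. This is what makes the increment a bounded operator on L². -/
lemma map_fst_pairMeasure_le (hk : AEMeasurable k) :
    (pairMeasure E k).map Prod.fst ≤ (∫⁻ z, ENNReal.ofReal (k z)) • volume.restrict E := by
  refine Measure.le_iff.2 fun s hs => ?_
  rw [Measure.map_apply measurable_fst hs, ← lintegral_indicator_one (measurable_fst hs),
    lintegral_pairMeasure hk ((measurable_one.indicator (measurable_fst hs)).aemeasurable)]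
  calc ∫⁻ x in E, ∫⁻ y in E, ENNReal.ofReal (k (y - x)) *
          (Prod.fst ⁻¹' s).indicator (1 : Eu d × Eu d → ℝ≥0∞) (x, y)
      ≤ ∫⁻ x in E, s.indicator (fun _ => ∫⁻ z, ENNReal.ofReal (k z)) x := by
        refine lintegral_mono fun x => ?_
        by_cases hx : x ∈ s
        · simp only [indicator_of_mem hx]
          refine le_trans (le_of_eq ?_) (setLIntegral_kernel_le (k := k) E x)
          refine lintegral_congr fun y => ?_
          rw [indicator_of_mem (by exact hx)]; simp
        · have : ∀ y, (Prod.fst ⁻¹' s).indicator (1 : Eu d × Eu d → ℝ≥0∞) (x, y) = 0 :=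
            fun y => indicator_of_notMem (by exact hx) _
          simp [this]
    _ = ((∫⁻ z, ENNReal.ofReal (k z)) • volume.restrict E) s := by
        rw [lintegral_indicator_const hs]; rfl

lemma measurePreserving_swap_pairMeasure (hk : AEMeasurable k) (hke : ∀ z, k (-z) = k z) :
    MeasurePreserving Prod.swap (pairMeasure E k) (pairMeasure E k) := by
  refine ⟨measurable_swap, Measure.ext fun s hs => ?_⟩
  have hk' := (aemeasurable_kernel hk E).ennreal_ofReal
  rw [Measure.map_apply measurable_swap hs, pairMeasure,
    withDensity_apply _ (measurable_swap hs), withDensity_apply _ hs,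
    ← lintegral_indicator (measurable_swap hs), ← lintegral_indicator hs]
  have h := (Measure.measurePreserving_swap (μ := volume.restrict E)
    (ν := volume.restrict E)).lintegral_comp_emb MeasurableEquiv.prodComm.measurableEmbedding
      (s.indicator fun p : Eu d × Eu d => ENNReal.ofReal (k (p.2 - p.1)))
  rw [← h]
  refine lintegral_congr fun p => ?_
  by_cases hp : p.swap ∈ s
  · rw [indicator_of_mem hp, indicator_of_mem (by exact hp), ← hke]; simp
  · rw [indicator_of_notMem hp, indicator_of_notMem (by exact hp)]

lemma memLp_comp_fst (hk : Integrable k) {u : Eu d → ℝ}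
    (hu : MemLp u 2 (volume.restrict E)) :
    MemLp (fun p : Eu d × Eu d => u p.1) 2 (pairMeasure E k) ∧
    eLpNorm (fun p : Eu d × Eu d => u p.1) 2 (pairMeasure E k)
      ≤ (∫⁻ z, ENNReal.ofReal (k z)) ^ (1 / 2 : ℝ) * eLpNorm u 2 (volume.restrict E) := by
  have hm := map_fst_pairMeasure_le (E := E) hk.aestronglyMeasurable.aemeasurable
  have hfin : ∫⁻ z, ENNReal.ofReal (k z) ≠ ∞ := hk.lintegral_lt_top.ne
  have hu' : MemLp u 2 ((∫⁻ z, ENNReal.ofReal (k z)) • volume.restrict E) :=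
    hu.smul_measure hfin
  have hu'' := hu'.mono_measure hm
  refine ⟨(memLp_map_measure_iff hu''.aestronglyMeasurable measurable_fst.aemeasurable).1 hu'', ?_⟩
  have h1 := eLpNorm_map_measure (p := 2) hu''.aestronglyMeasurable
    (measurable_fst.aemeasurable (μ := pairMeasure E k))
  change eLpNorm (u ∘ Prod.fst) 2 _ ≤ _
  rw [← h1]
  refine (eLpNorm_mono_measure u hm).trans ?_
  rw [eLpNorm_smul_measure_of_ne_top (by simp)]
  simp

lemma memLp_comp_snd (hk : Integrable k) (hke : ∀ z, k (-z) = k z) {u : Eu d → ℝ}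
    (hu : MemLp u 2 (volume.restrict E)) :
    MemLp (fun p : Eu d × Eu d => u p.2) 2 (pairMeasure E k) ∧
    eLpNorm (fun p : Eu d × Eu d => u p.2) 2 (pairMeasure E k)
      ≤ (∫⁻ z, ENNReal.ofReal (k z)) ^ (1 / 2 : ℝ) * eLpNorm u 2 (volume.restrict E) := by
  have hs := measurePreserving_swap_pairMeasure (E := E) hk.aestronglyMeasurable.aemeasurable hke
  obtain ⟨h1, h2⟩ := memLp_comp_fst hk hu
  refine ⟨h1.comp_measurePreserving hs, ?_⟩
  rw [← eLpNorm_comp_measurePreserving h1.aestronglyMeasurable hs] at h2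
  exact h2

lemma memLp_increment (hk : Integrable k) (hke : ∀ z, k (-z) = k z) {u : Eu d → ℝ}
    (hu : MemLp u 2 (volume.restrict E)) : MemLp (increment u) 2 (pairMeasure E k) :=
  (memLp_comp_snd hk hke hu).1.sub (memLp_comp_fst hk hu).1

/-- Triangle inequality on u(y) - u(x), both marginals being dominated by the mass of k. With mass
O(δ⁻²) the loss is a factor O(δ⁻¹), the origin of δ⁻¹ in front of h². -/
lemma eLpNorm_increment_le (hk : Integrable k) (hke : ∀ z, k (-z) = k z) {u : Eu d → ℝ}
    (hu : MemLp u 2 (volume.restrict E)) :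
    eLpNorm (increment u) 2 (pairMeasure E k)
      ≤ 2 * ((∫⁻ z, ENNReal.ofReal (k z)) ^ (1 / 2 : ℝ) * eLpNorm u 2 (volume.restrict E)) := by
  have h1 := memLp_comp_fst hk hu
  have h2 := memLp_comp_snd hk hke hu
  rw [two_mul]
  exact (eLpNorm_sub_le h2.1.aestronglyMeasurable h1.1.aestronglyMeasurable (by norm_num)).trans
    (add_le_add h2.2 h1.2)

lemma eLpNorm_increment_sq (hk : AEMeasurable k) {u : Eu d → ℝ}
    (hu : AEStronglyMeasurable u (volume.restrict E)) :
    eLpNorm (increment u) 2 (pairMeasure E k) ^ 2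
      = ∫⁻ x in E, ∫⁻ y in E, ENNReal.ofReal (k (y - x)) * ENNReal.ofReal ((u y - u x) ^ 2) := by
  have hF : AEMeasurable (fun p : Eu d × Eu d => ENNReal.ofReal ((u p.2 - u p.1) ^ 2))
      ((volume.restrict E).prod (volume.restrict E)) :=
    ((hu.comp_snd.sub hu.comp_fst).aemeasurable.pow_const 2).ennreal_ofReal
  rw [← lintegral_pairMeasure hk hF, eLpNorm_eq_lintegral_rpow_enorm_toReal (by simp) (by simp),
    ← ENNReal.rpow_natCast, ← ENNReal.rpow_mul]
  simp only [ENNReal.toReal_ofNat, Nat.cast_ofNat]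
  norm_num
  refine lintegral_congr fun p => ?_
  rw [increment, Real.enorm_eq_ofReal_abs, ← ENNReal.ofReal_pow (abs_nonneg _), sq_abs]

lemma energyNorm_eq {Ω : Set (Eu d)} {δ : ℝ} {γ : Eu d → Eu d → ℝ}
    (hγ : ∀ x y, γ x y = k (y - x)) (hk : AEMeasurable k) {u : Eu d → ℝ}
    (hu : AEStronglyMeasurable u (volume.restrict (extendedDomain Ω δ))) :
    energyNorm Ω δ γ u = eLpNorm (increment u) 2 (pairMeasure (extendedDomain Ω δ) k) := by
  have h : energyNorm Ω δ γ u
      = (eLpNorm (increment u) 2 (pairMeasure (extendedDomain Ω δ) k) ^ 2) ^ (1 / 2 : ℝ) := by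
    rw [energyNorm, eLpNorm_increment_sq hk hu]
    congr 1
    refine lintegral_congr fun x => lintegral_congr fun y => ?_
    rw [ENNReal.ofReal_mul (sq_nonneg _), mul_comm, hγ]
  rw [h, ← ENNReal.rpow_natCast, ← ENNReal.rpow_mul]
  norm_num

end NonlocalCDG

/-! ### The energy inner product and the nonlocal Green identity -/

namespace NonlocalCDG

variable {d : ℕ} {E : Set (Eu d)} {k : Eu d → ℝ}

lemma integrable_pairMeasure_iff (hk : AEMeasurable k) (hk0 : ∀ z, 0 ≤ k z)
    {F : Eu d × Eu d → ℝ} :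
    Integrable F (pairMeasure E k) ↔ Integrable (fun p : Eu d × Eu d => k (p.2 - p.1) * F p)
      ((volume.restrict E).prod (volume.restrict E)) := by
  rw [pairMeasure, integrable_withDensity_iff_integrable_smul₀'
    (aemeasurable_kernel hk E).ennreal_ofReal (by simp)]
  simp [ENNReal.toReal_ofReal, hk0]

lemma integral_pairMeasure (hk : AEMeasurable k) (hk0 : ∀ z, 0 ≤ k z)
    {F : Eu d × Eu d → ℝ} (hF : Integrable F (pairMeasure E k)) :
    ∫ p, F p ∂(pairMeasure E k) = ∫ x in E, ∫ y in E, k (y - x) * F (x, y) := by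
  rw [← integral_prod _ ((integrable_pairMeasure_iff hk hk0).1 hF), pairMeasure,
    integral_withDensity_eq_integral_toReal_smul₀
      (aemeasurable_kernel hk E).ennreal_ofReal (by simp)]
  simp [ENNReal.toReal_ofReal, hk0]

lemma integrable_integral_pairMeasure (hk : AEMeasurable k) (hk0 : ∀ z, 0 ≤ k z)
    {F : Eu d × Eu d → ℝ} (hF : Integrable F (pairMeasure E k)) {S : Set (Eu d)}
    (hS : MeasurableSet S) (hSE : S ⊆ E) :
    Integrable (fun x => ∫ y in S, k (y - x) * F (x, y)) (volume.restrict E) := by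
  have h := ((integrable_pairMeasure_iff hk hk0).1
    (hF.indicator (measurable_snd hS))).integral_prod_left
  refine h.congr (Eventually.of_forall fun x => ?_)
  simp only
  rw [← inter_eq_self_of_subset_left hSE, ← Measure.restrict_restrict hS,
    ← integral_indicator hS]
  refine integral_congr_ae (Eventually.of_forall fun y => ?_)
  by_cases hy : y ∈ S
  · simp [hy, hSE hy]
  · simp [hy]

lemma ae_integrable_pairMeasure (hk : AEMeasurable k) (hk0 : ∀ z, 0 ≤ k z)
    {F : Eu d × Eu d → ℝ} (hF : Integrable F (pairMeasure E k)) :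
    ∀ᵐ x ∂(volume.restrict E),
      Integrable (fun y => k (y - x) * F (x, y)) (volume.restrict E) :=
  ((integrable_pairMeasure_iff hk hk0).1 hF).prod_right_ae

/-- The increment of an `L²` function, as an element of `L²` of the pair measure. -/
noncomputable def incrementLp (hk : Integrable k) (hke : ∀ z, k (-z) = k z) {u : Eu d → ℝ}
    (hu : MemLp u 2 (volume.restrict E)) : Lp ℝ 2 (pairMeasure E k) :=
  (memLp_increment hk hke hu).toLp

lemma norm_incrementLp (hk : Integrable k) (hke : ∀ z, k (-z) = k z) {u : Eu d → ℝ}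
    (hu : MemLp u 2 (volume.restrict E)) :
    ‖incrementLp hk hke hu‖ = (eLpNorm (increment u) 2 (pairMeasure E k)).toReal :=
  Lp.norm_toLp _ _

lemma incrementLp_add (hk : Integrable k) (hke : ∀ z, k (-z) = k z) {u v : Eu d → ℝ}
    (hu : MemLp u 2 (volume.restrict E)) (hv : MemLp v 2 (volume.restrict E)) :
    incrementLp hk hke (hu.add hv) = incrementLp hk hke hu + incrementLp hk hke hv := by
  rw [incrementLp, incrementLp, incrementLp, ← MemLp.toLp_add]
  congr 1
  ext p
  simp only [increment, Pi.add_apply]; ring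

lemma incrementLp_sub (hk : Integrable k) (hke : ∀ z, k (-z) = k z) {u v : Eu d → ℝ}
    (hu : MemLp u 2 (volume.restrict E)) (hv : MemLp v 2 (volume.restrict E)) :
    incrementLp hk hke (hu.sub hv) = incrementLp hk hke hu - incrementLp hk hke hv := by
  rw [incrementLp, incrementLp, incrementLp, ← MemLp.toLp_sub]
  congr 1
  ext p
  simp only [increment, Pi.sub_apply]; ring

lemma incrementLp_congr (hk : Integrable k) (hke : ∀ z, k (-z) = k z) {u v : Eu d → ℝ}
    (hu : MemLp u 2 (volume.restrict E)) (hv : MemLp v 2 (volume.restrict E))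
    (h : u =ᵐ[volume.restrict E] v) : incrementLp hk hke hu = incrementLp hk hke hv := by
  rw [incrementLp, incrementLp, MemLp.toLp_eq_toLp_iff]
  refine (pairMeasure_absolutelyContinuous E k).ae_le ?_
  have h1 := Measure.quasiMeasurePreserving_fst (μ := volume.restrict E)
    (ν := volume.restrict E) |>.ae_eq_comp h
  have h2 := Measure.quasiMeasurePreserving_snd (μ := volume.restrict E)
    (ν := volume.restrict E) |>.ae_eq_comp h
  filter_upwards [h1, h2] with p hp1 hp2
  simp only [Function.comp_apply] at hp1 hp2
  rw [increment, increment, hp1, hp2]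

lemma inner_incrementLp (hk : Integrable k) (hke : ∀ z, k (-z) = k z) {u w : Eu d → ℝ}
    (hu : MemLp u 2 (volume.restrict E)) (hw : MemLp w 2 (volume.restrict E)) :
    inner ℝ (incrementLp hk hke hu) (incrementLp hk hke hw)
      = ∫ p, increment u p * increment w p ∂(pairMeasure E k) := by
  rw [L2.inner_def]
  refine integral_congr_ae ?_
  filter_upwards [(memLp_increment hk hke hu).coeFn_toLp,
    (memLp_increment hk hke hw).coeFn_toLp] with p h1 h2
  rw [incrementLp, incrementLp, h1, h2]
  simp [mul_comm]

lemma integrable_mul_increment (hk : Integrable k) (hke : ∀ z, k (-z) = k z) {u w : Eu d → ℝ}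
    (hu : MemLp u 2 (volume.restrict E)) (hw : MemLp w 2 (volume.restrict E)) :
    Integrable (fun p : Eu d × Eu d => w p.1 * increment u p) (pairMeasure E k) :=
  (memLp_comp_fst hk hw).1.integrable_mul (memLp_increment hk hke hu)

/-- The swap preserves the pair measure and changes the sign of the increment of u, so w(x) may be
traded for -w(y); averaging both forms produces the increment of w. -/
lemma two_mul_integral_mul_increment (hk : Integrable k) (hke : ∀ z, k (-z) = k z)
    {u w : Eu d → ℝ}
    (hu : MemLp u 2 (volume.restrict E)) (hw : MemLp w 2 (volume.restrict E)) :
    -2 * ∫ p : Eu d × Eu d, w p.1 * increment u p ∂(pairMeasure E k)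
      = inner ℝ (incrementLp hk hke hu) (incrementLp hk hke hw) := by
  have hs := measurePreserving_swap_pairMeasure (E := E) hk.aestronglyMeasurable.aemeasurable hke
  have hI := integrable_mul_increment hk hke hu hw
  have hswap : ∫ p : Eu d × Eu d, w p.1 * increment u p ∂(pairMeasure E k)
      = -∫ p : Eu d × Eu d, w p.2 * increment u p ∂(pairMeasure E k) := by
    rw [← hs.integral_comp MeasurableEquiv.prodComm.measurableEmbedding, ← integral_neg]
    refine integral_congr_ae (Eventually.of_forall fun p => ?_)
    simp only [increment, Prod.fst_swap, Prod.snd_swap]; ring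
  have hI2 : Integrable (fun p : Eu d × Eu d => w p.2 * increment u p) (pairMeasure E k) :=
    (memLp_comp_snd hk hke hw).1.integrable_mul (memLp_increment hk hke hu)
  have hsub := integral_sub hI2 hI
  rw [inner_incrementLp]
  have : ∫ p, increment u p * increment w p ∂(pairMeasure E k)
      = ∫ p : Eu d × Eu d, (w p.2 * increment u p - w p.1 * increment u p) ∂(pairMeasure E k) := by
    refine integral_congr_ae (Eventually.of_forall fun p => ?_)
    simp only [increment]; ring
  rw [this, hsub]
  linarith

/-- Nonlocal Green identity, for test functions vanishing outside of `Ω`. -/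
lemma nonlocal_green (hk : Integrable k) (hk0 : ∀ z, 0 ≤ k z) (hke : ∀ z, k (-z) = k z)
    (hE : MeasurableSet E) {Ω : Set (Eu d)} (hΩE : Ω ⊆ E) {u w : Eu d → ℝ}
    (hu : MemLp u 2 (volume.restrict E)) (hw : MemLp w 2 (volume.restrict E))
    (hw0 : ∀ x ∉ Ω, w x = 0) :
    -2 * ∫ x in Ω, w x * ∫ y in E, (u y - u x) * k (y - x)
      = inner ℝ (incrementLp hk hke hu) (incrementLp hk hke hw) := by
  rw [← two_mul_integral_mul_increment hk hke hu hw,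
    integral_pairMeasure hk.aestronglyMeasurable.aemeasurable hk0
      (integrable_mul_increment hk hke hu hw),
    ← setIntegral_eq_of_subset_of_forall_sdiff_eq_zero hE hΩE
      (fun x hx => by rw [hw0 x hx.2, zero_mul])]
  congr 1
  refine integral_congr_ae (Eventually.of_forall fun x => ?_)
  simp only
  rw [← integral_const_mul]
  refine integral_congr_ae (Eventually.of_forall fun y => ?_)
  simp only [increment]; ring

end NonlocalCDG

/-! ### Nonlocal Poincaré inequality -/

namespace NonlocalCDG

variable {d : ℕ} {E : Set (Eu d)} {k : Eu d → ℝ}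

/-- Telescoping: a shift by n • z is n shifts by z, and each increment has the same norm by
translation invariance. -/
lemma eLpNorm_translate_sub_le {w : Eu d → ℝ} (hw : AEStronglyMeasurable w volume) (z : Eu d)
    (n : ℕ) :
    eLpNorm (fun x => w (x + n • z) - w x) 2 volume
      ≤ n * eLpNorm (fun x => w (x + z) - w x) 2 volume := by
  have ht : ∀ a : Eu d, AEStronglyMeasurable (fun x => w (x + a)) volume := fun a =>
    hw.comp_measurePreserving (measurePreserving_add_right volume a)
  induction n with
  | zero => simp
  | succ n ih =>
    have h1 : (fun x => w (x + (n + 1) • z) - w x)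
        = (fun x => w (x + n • z + z) - w (x + n • z)) + fun x => w (x + n • z) - w x := by
      ext x
      simp only [Pi.add_apply, succ_nsmul, add_assoc, sub_add_sub_cancel]
    have h2 : eLpNorm (fun x => w (x + n • z + z) - w (x + n • z)) 2 volume
        = eLpNorm (fun x => w (x + z) - w x) 2 volume :=
      eLpNorm_comp_measurePreserving (g := fun x => w (x + z) - w x) ((ht z).sub hw)
        (measurePreserving_add_right volume (n • z))
    rw [h1]
    refine (eLpNorm_add_le ?_ ((ht _).sub hw) (by norm_num)).trans ?_
    · exact ((ht z).sub hw).comp_measurePreserving (measurePreserving_add_right volume (n • z))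
    · rw [h2, Nat.cast_succ, add_mul, one_mul, add_comm]
      exact add_le_add_left ih _

lemma eLpNorm_le_translate_sub {Ω : Set (Eu d)} {w : Eu d → ℝ}
    (hw0 : ∀ x ∉ Ω, w x = 0) {a : Eu d} (ha : ∀ x ∈ Ω, x + a ∉ Ω) :
    eLpNorm w 2 volume ≤ eLpNorm (fun x => w (x + a) - w x) 2 volume := by
  refine eLpNorm_mono fun x => ?_
  by_cases hx : x ∈ Ω
  · rw [hw0 _ (ha x hx)]; simp
  · rw [hw0 x hx]; simp

/-- A function supported in a set of diameter `D` is controlled by its difference quotients. -/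
lemma norm_mul_eLpNorm_le {Ω : Set (Eu d)} {D δ : ℝ} (hD0 : 0 ≤ D)
    (hD : ∀ x ∈ Ω, ∀ y ∈ Ω, ‖y - x‖ ≤ D) {w : Eu d → ℝ}
    (hw : AEStronglyMeasurable w volume) (hw0 : ∀ x ∉ Ω, w x = 0) {z : Eu d} (hz : ‖z‖ ≤ δ) :
    ENNReal.ofReal ‖z‖ * eLpNorm w 2 volume
      ≤ ENNReal.ofReal (D + δ) * eLpNorm (fun x => w (x + z) - w x) 2 volume := by
  rcases eq_or_ne z 0 with rfl | hz0
  · simp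
  have hzp : 0 < ‖z‖ := norm_pos_iff.2 hz0
  -- The least number of shifts by z that certainly moves Ω off itself: n‖z‖ exceeds D but is at
  -- most D + ‖z‖ ≤ D + δ.
  set n : ℕ := ⌊D / ‖z‖⌋₊ + 1 with hn
  have hn1 : D < n * ‖z‖ := by
    have := Nat.lt_floor_add_one (D / ‖z‖)
    rw [div_lt_iff₀ hzp] at this
    rw [hn]; push_cast; exact this
  have hn2 : n * ‖z‖ ≤ D + δ := by
    have := Nat.floor_le (div_nonneg hD0 hzp.le)
    rw [le_div_iff₀ hzp] at this
    rw [hn]; push_cast; linarith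
  have ha : ∀ x ∈ Ω, x + n • z ∉ Ω := by
    intro x hx hx'
    have := hD x hx _ hx'
    rw [add_sub_cancel_left, ← Nat.cast_smul_eq_nsmul ℝ, norm_smul, Real.norm_natCast] at this
    linarith
  calc ENNReal.ofReal ‖z‖ * eLpNorm w 2 volume
      ≤ ENNReal.ofReal ‖z‖ * (n * eLpNorm (fun x => w (x + z) - w x) 2 volume) := by
        gcongr
        exact (eLpNorm_le_translate_sub hw0 ha).trans (eLpNorm_translate_sub_le hw z n)
    _ = ENNReal.ofReal (n * ‖z‖) * eLpNorm (fun x => w (x + z) - w x) 2 volume := by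
        rw [ENNReal.ofReal_mul (by positivity), ENNReal.ofReal_natCast]; ring
    _ ≤ _ := by gcongr

lemma lintegral_ofReal_sq_eq (f : Eu d → ℝ) :
    ∫⁻ x, ENNReal.ofReal (f x ^ 2) = eLpNorm f 2 volume ^ 2 := by
  rw [eLpNorm_eq_lintegral_rpow_enorm_toReal (by simp) (by simp),
    ← ENNReal.rpow_natCast, ← ENNReal.rpow_mul]
  simp only [ENNReal.toReal_ofNat, Nat.cast_ofNat]
  norm_num
  refine lintegral_congr fun p => ?_
  rw [Real.enorm_eq_ofReal_abs, ← ENNReal.ofReal_pow (abs_nonneg _), sq_abs]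

/-- Nonlocal Poincaré inequality, with a constant that only depends on the diameter of `Ω`, on the
horizon and on a lower bound of the second moment of the kernel. -/
lemma nonlocal_poincare (hk : AEMeasurable k) {Ω : Set (Eu d)}
    {D δ : ℝ} (hD0 : 0 ≤ D)
    (hD : ∀ x ∈ Ω, ∀ y ∈ Ω, ‖y - x‖ ≤ D)
    (hks : ∀ z, δ ≤ ‖z‖ → k z = 0)
    (hE : MeasurableSet E) (hΩE : ∀ x ∈ Ω, Metric.ball x δ ⊆ E) (hΩE' : Ω ⊆ E)
    (hmom : 1 ≤ ∫⁻ z : Eu d, ENNReal.ofReal (k z) * ENNReal.ofReal ‖z‖ ^ 2)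
    {w : Eu d → ℝ} (hw : AEStronglyMeasurable w volume) (hw0 : ∀ x ∉ Ω, w x = 0) :
    eLpNorm w 2 volume ≤ ENNReal.ofReal (D + δ) * eLpNorm (increment w) 2 (pairMeasure E k) := by
  set F : Eu d × Eu d → ℝ≥0∞ :=
    fun p => ENNReal.ofReal (k (p.2 - p.1)) * ENNReal.ofReal ((w p.2 - w p.1) ^ 2) with hF
  have hFm : AEMeasurable F (volume.prod volume) :=
    (aemeasurable_kernel_prod hk).ennreal_ofReal.mul
      (((hw.comp_snd.sub hw.comp_fst).aemeasurable.pow_const 2).ennreal_ofReal)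
  -- A pair contributes only if its points are closer than δ and one of them lies in Ω; then both
  -- lie in E. Hence E × E can be replaced by the whole space, where the substitution y = x + z is
  -- free.
  have hF0 : ∀ x y, ¬ (x ∈ E ∧ y ∈ E) → F (x, y) = 0 := by
    intro x y hxy
    by_contra hne
    simp only [hF, mul_eq_zero, not_or] at hne
    have hdist : ‖y - x‖ < δ := by
      by_contra h
      exact hne.1 (by rw [hks _ (not_lt.1 h)]; simp)
    have hor : x ∈ Ω ∨ y ∈ Ω := by
      by_contra h
      push Not at h
      exact hne.2 (by rw [hw0 x h.1, hw0 y h.2]; simp)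
    rcases hor with h | h
    · exact hxy ⟨hΩE' h, hΩE x h (by rwa [Metric.mem_ball, dist_eq_norm])⟩
    · exact hxy ⟨hΩE y h (by rwa [Metric.mem_ball, dist_comm, dist_eq_norm]), hΩE' h⟩
  have hsq : eLpNorm (increment w) 2 (pairMeasure E k) ^ 2 = ∫⁻ x, ∫⁻ y, F (x, y) := by
    rw [eLpNorm_increment_sq hk hw.restrict, ← lintegral_indicator hE]
    refine lintegral_congr fun x => ?_
    by_cases hx : x ∈ E
    · rw [indicator_of_mem hx, ← lintegral_indicator hE]
      refine lintegral_congr fun y => ?_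
      by_cases hy : y ∈ E
      · rw [indicator_of_mem hy]
      · rw [indicator_of_notMem hy, hF0 x y (fun h => hy h.2)]
    · rw [indicator_of_notMem hx]
      simp [hF0 x _ (fun h => hx h.1)]
  have hshift : ∫⁻ x, ∫⁻ y, F (x, y)
      = ∫⁻ z, ENNReal.ofReal (k z) * eLpNorm (fun x => w (x + z) - w x) 2 volume ^ 2 := by
    have h1 : ∀ x, ∫⁻ y, F (x, y) = ∫⁻ z, F (x, x + z) := fun x =>
      (lintegral_add_left_eq_self (fun y => F (x, y)) x).symm
    simp_rw [h1]
    rw [lintegral_lintegral_swap]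
    · refine lintegral_congr fun z => ?_
      simp only [hF, add_sub_cancel_left]
      rw [lintegral_const_mul' _ _ ENNReal.ofReal_ne_top, lintegral_ofReal_sq_eq]
    · exact hFm.comp_quasiMeasurePreserving
        (measurePreserving_prod_add (volume : Measure (Eu d)) volume).quasiMeasurePreserving
  have hmain : eLpNorm w 2 volume ^ 2
      ≤ (ENNReal.ofReal (D + δ) * eLpNorm (increment w) 2 (pairMeasure E k)) ^ 2 := by
    rw [mul_pow, hsq, hshift, ← lintegral_const_mul' _ _ (by simp)]
    calc eLpNorm w 2 volume ^ 2
        ≤ (∫⁻ z : Eu d, ENNReal.ofReal (k z) * ENNReal.ofReal ‖z‖ ^ 2)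
          * eLpNorm w 2 volume ^ 2 := le_mul_of_one_le_left zero_le hmom
      _ = ∫⁻ z : Eu d, ENNReal.ofReal (k z) * ENNReal.ofReal ‖z‖ ^ 2
          * eLpNorm w 2 volume ^ 2 := by
        rw [lintegral_mul_const'']
        exact hk.ennreal_ofReal.mul (by fun_prop)
      _ ≤ _ := by
        -- For each shift z in the support of k, the translation estimate is squared and weighted by
        -- k(z); the left side was prepared by spending the second moment, which is at least 1.
        refine lintegral_mono fun z => ?_
        by_cases hz : δ ≤ ‖z‖
        · simp [hks z hz]
        · have := norm_mul_eLpNorm_le hD0 hD hw hw0 (not_le.1 hz).le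
          calc ENNReal.ofReal (k z) * ENNReal.ofReal ‖z‖ ^ 2 * eLpNorm w 2 volume ^ 2
              = ENNReal.ofReal (k z) * (ENNReal.ofReal ‖z‖ * eLpNorm w 2 volume) ^ 2 := by ring
            _ ≤ ENNReal.ofReal (k z) * (ENNReal.ofReal (D + δ)
                * eLpNorm (fun x => w (x + z) - w x) 2 volume) ^ 2 := by gcongr
            _ = _ := by ring
  exact (ENNReal.pow_le_pow_left_iff two_ne_zero).1 hmain

end NonlocalCDG

/-! ### Taylor estimates along segments -/

namespace NonlocalCDG

variable {d : ℕ}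

section Taylor

/-- One integration over [0, 1]. Iterating it gives Taylor bounds without the factorials, whose
values do not matter here. -/
lemma abs_le_of_abs_deriv_le {h h' : ℝ → ℝ} {B : ℝ}
    (hd : ∀ t ∈ Icc (0 : ℝ) 1, HasDerivAt h (h' t) t) (h0 : h 0 = 0)
    (hB : ∀ t ∈ Icc (0 : ℝ) 1, |h' t| ≤ B) : ∀ t ∈ Icc (0 : ℝ) 1, |h t| ≤ B := by
  intro t ht
  have h1 := norm_image_sub_le_of_norm_deriv_le_segment' (f := h) (f' := h') (C := B)
    (fun s hs => (hd s hs).hasDerivWithinAt) (fun s hs => hB s (Ico_subset_Icc_self hs)) t ht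
  rw [h0, sub_zero, sub_zero, Real.norm_eq_abs] at h1
  have hB0 : 0 ≤ B := (abs_nonneg _).trans (hB t ht)
  exact h1.trans (mul_le_of_le_one_right hB0 ht.2)

variable {F : Type*} [NormedAddCommGroup F] [NormedSpace ℝ F] {f : F → ℝ} {D : Set F}

lemma hasDerivAt_iteratedFDeriv_line {n : ℕ} (hD : IsOpen D) (hf : ContDiffOn ℝ n f D) {j : ℕ}
    (hj : j < n) (x z : F) {t : ℝ} (ht : x + t • z ∈ D) :
    HasDerivAt (fun s : ℝ => iteratedFDeriv ℝ j f (x + s • z) fun _ => z)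
      (iteratedFDeriv ℝ (j + 1) f (x + t • z) fun _ => z) t := by
  have hc : ContDiffAt ℝ n f (x + t • z) := hf.contDiffAt (hD.mem_nhds ht)
  have h1 := (hc.differentiableAt_iteratedFDeriv (m := j) (by exact_mod_cast hj)).hasFDerivAt
  have hl : HasDerivAt (fun s : ℝ => x + s • z) z t := by
    simpa using ((hasDerivAt_id t).smul_const z).const_add x
  have h2 := h1.comp_hasDerivAt t hl
  have h3 := (ContinuousMultilinearMap.apply ℝ (fun _ : Fin j => F) ℝ
    (fun _ => z)).hasFDerivAt.comp_hasDerivAt t h2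
  rw [iteratedFDeriv_succ_apply_left]
  exact h3

lemma abs_iteratedFDeriv_le {n : ℕ} {M : ℝ} (hD : IsOpen D)
    (hM : ∀ x ∈ D, ‖iteratedFDerivWithin ℝ n f D x‖ ≤ M) {x : F} (hx : x ∈ D) (z : F) :
    |iteratedFDeriv ℝ n f x fun _ => z| ≤ M * ‖z‖ ^ n := by
  have h := (iteratedFDeriv ℝ n f x).le_opNorm fun _ => z
  rw [Finset.prod_const, Finset.card_univ, Fintype.card_fin, Real.norm_eq_abs] at h
  refine h.trans ?_
  gcongr
  rw [← iteratedFDerivWithin_of_isOpen n hD hx]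
  exact hM x hx

/-- Taylor's formula of order one along a segment. -/
lemma abs_sub_sub_iteratedFDeriv_le {M : ℝ} (hD : IsOpen D) (hf : ContDiffOn ℝ (2 : ℕ) f D)
    (hM : ∀ x ∈ D, ‖iteratedFDerivWithin ℝ 2 f D x‖ ≤ M) {x z : F}
    (hseg : ∀ t ∈ Icc (0 : ℝ) 1, x + t • z ∈ D) :
    |f (x + z) - f x - fderiv ℝ f x z| ≤ M * ‖z‖ ^ 2 := by
  set g : ℕ → ℝ → ℝ := fun j t => iteratedFDeriv ℝ j f (x + t • z) fun _ => z with hg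
  have hd : ∀ j < 2, ∀ t ∈ Icc (0 : ℝ) 1, HasDerivAt (g j) (g (j + 1) t) t := fun j hj t ht =>
    hasDerivAt_iteratedFDeriv_line hD hf hj x z (hseg t ht)
  have h2 : ∀ t ∈ Icc (0 : ℝ) 1, |g 2 t| ≤ M * ‖z‖ ^ 2 := fun t ht =>
    abs_iteratedFDeriv_le hD hM (hseg t ht) z
  have h1 := abs_le_of_abs_deriv_le (h := fun t => g 1 t - g 1 0) (h' := g 2)
    (fun t ht => (hd 1 (by norm_num) t ht).sub_const _) (by simp) h2
  have h0 := abs_le_of_abs_deriv_le (h := fun t => g 0 t - g 0 0 - t * g 1 0)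
    (h' := fun t => g 1 t - g 1 0)
    (fun t ht => (((hd 0 (by norm_num) t ht).sub_const _).sub
      ((hasDerivAt_id t).mul_const (g 1 0))).congr_deriv (by simp))
    (by simp) h1 1 (by simp)
  simpa [hg] using h0

/-- Taylor's formula for second differences. -/
lemma abs_second_difference_sub_le {M : ℝ} (hD : IsOpen D) (hf : ContDiffOn ℝ (4 : ℕ) f D)
    (hM : ∀ x ∈ D, ‖iteratedFDerivWithin ℝ 4 f D x‖ ≤ M) {x z : F}
    (hseg : ∀ t ∈ Icc (-1 : ℝ) 1, x + t • z ∈ D) :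
    |f (x + z) - f x + (f (x - z) - f x) - iteratedFDeriv ℝ 2 f x fun _ => z|
      ≤ 2 * M * ‖z‖ ^ 4 := by
  set g : ℕ → ℝ → ℝ := fun j t => iteratedFDeriv ℝ j f (x + t • z) fun _ => z with hg
  have hd : ∀ j < 4, ∀ t ∈ Icc (0 : ℝ) 1, HasDerivAt (g j) (g (j + 1) t) t := fun j hj t ht =>
    hasDerivAt_iteratedFDeriv_line hD hf hj x z (hseg t ⟨by linarith [ht.1], ht.2⟩)
  have hd' : ∀ j < 4, ∀ t ∈ Icc (0 : ℝ) 1,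
      HasDerivAt (fun t => g j (-t)) (-g (j + 1) (-t)) t := by
    intro j hj t ht
    have := hasDerivAt_iteratedFDeriv_line hD hf hj x z
      (hseg (-t) ⟨by linarith [ht.2], by linarith [ht.1]⟩)
    exact (HasDerivAt.scomp t (h := fun t : ℝ => -t) this (hasDerivAt_neg t)).congr_deriv
      (by simp [hg])
  have hb : ∀ t ∈ Icc (-1 : ℝ) 1, |g 4 t| ≤ M * ‖z‖ ^ 4 := fun t ht =>
    abs_iteratedFDeriv_le hD hM (hseg t ht) z
  have h4 : ∀ t ∈ Icc (0 : ℝ) 1, |g 4 t + g 4 (-t)| ≤ 2 * M * ‖z‖ ^ 4 := fun t ht => by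
    have a := hb t ⟨by linarith [ht.1], ht.2⟩
    have b := hb (-t) ⟨by linarith [ht.2], by linarith [ht.1]⟩
    calc _ ≤ |g 4 t| + |g 4 (-t)| := abs_add_le _ _
      _ ≤ _ := by linarith
  -- The bound on the fourth derivative is integrated four times. Symmetrising in t and -t makes the
  -- odd-order terms vanish at 0, so only the values g 2 0 and g 0 0 have to be subtracted.
  have h3 := abs_le_of_abs_deriv_le (h := fun t => g 3 t - g 3 (-t))
    (h' := fun t => g 4 t + g 4 (-t))
    (fun t ht => ((hd 3 (by norm_num) t ht).sub (hd' 3 (by norm_num) t ht)).congr_deriv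
      (by simp)) (by simp) h4
  have h2 := abs_le_of_abs_deriv_le (h := fun t => g 2 t + g 2 (-t) - 2 * g 2 0)
    (h' := fun t => g 3 t - g 3 (-t))
    (fun t ht => by
      simpa [sub_eq_add_neg] using
        ((hd 2 (by norm_num) t ht).add (hd' 2 (by norm_num) t ht)).sub_const (2 * g 2 0))
    (by simp; ring) h3
  have h1 := abs_le_of_abs_deriv_le (h := fun t => g 1 t - g 1 (-t) - t * (2 * g 2 0))
    (h' := fun t => g 2 t + g 2 (-t) - 2 * g 2 0)
    (fun t ht => (((hd 1 (by norm_num) t ht).sub (hd' 1 (by norm_num) t ht)).sub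
        ((hasDerivAt_id t).mul_const (2 * g 2 0))).congr_deriv (by simp))
    (by simp) h2
  have h0 := abs_le_of_abs_deriv_le
    (h := fun t => g 0 t + g 0 (-t) - 2 * g 0 0 - t ^ 2 * g 2 0)
    (h' := fun t => g 1 t - g 1 (-t) - t * (2 * g 2 0))
    (fun t ht => by
      have h5 := (((hd 0 (by norm_num) t ht).add (hd' 0 (by norm_num) t ht)).sub_const
        (2 * g 0 0)).sub ((hasDerivAt_pow 2 t).mul_const (g 2 0))
      refine (h5.congr_deriv ?_)
      push_cast; ring)
    (by simp; ring) h1 1 (by simp)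
  refine le_trans (le_of_eq ?_) h0
  congr 1
  simp [hg, sub_eq_add_neg]
  ring

end Taylor

end NonlocalCDG

/-! ### Radial kernels: moments and consistency with the Laplacian -/

namespace NonlocalCDG

variable {d : ℕ}

/-- A nonnegative integrable radial kernel supported in the ball of radius `δ`, with second
moment `d`. -/
structure IsRadialKernel (δ : ℝ) (k : Eu d → ℝ) : Prop where
  integrable : Integrable k
  nonneg : ∀ z, 0 ≤ k z
  radial : ∀ z z', ‖z‖ = ‖z'‖ → k z = k z'
  support : ∀ z, δ ≤ ‖z‖ → k z = 0
  moment : ∫ z, ‖z‖ ^ 2 * k z = d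

namespace IsRadialKernel

variable {δ : ℝ} {k : Eu d → ℝ}

lemma even (hk : IsRadialKernel δ k) (z : Eu d) : k (-z) = k z := hk.radial _ _ (norm_neg z)

lemma aemeasurable (hk : IsRadialKernel δ k) : AEMeasurable k :=
  hk.integrable.aestronglyMeasurable.aemeasurable

lemma integrable_mul (hk : IsRadialKernel δ k) {F : Eu d → ℝ} {C : ℝ}
    (hF : ContinuousOn F (Metric.ball 0 δ)) (hC : ∀ z ∈ Metric.ball (0 : Eu d) δ, |F z| ≤ C) :
    Integrable fun z => F z * k z := by
  have h1 : IntegrableOn (fun z => F z * k z) (Metric.ball 0 δ) :=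
    hk.integrable.integrableOn.bdd_mul (c := C)
      (hF.aestronglyMeasurable Metric.isOpen_ball.measurableSet)
      ((ae_restrict_iff' Metric.isOpen_ball.measurableSet).2 (Eventually.of_forall hC))
  refine (integrableOn_iff_integrable_of_support_subset fun z hz => ?_).1 h1
  by_contra h
  rw [mem_ball_zero_iff, not_lt] at h
  exact hz (by simp only [hk.support z h, mul_zero])

lemma integrable_sq_mul (hk : IsRadialKernel δ k) : Integrable fun z => ‖z‖ ^ 2 * k z := by
  refine hk.integrable_mul (C := δ ^ 2) (by fun_prop) fun z hz => ?_
  rw [mem_ball_zero_iff] at hz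
  rw [abs_of_nonneg (by positivity)]
  gcongr

lemma integrable_coord_mul (hk : IsRadialKernel δ k) (i j : Fin d) :
    Integrable fun z : Eu d => z i * z j * k z := by
  refine hk.integrable_mul (C := δ * δ) (by fun_prop) fun z hz => ?_
  rw [mem_ball_zero_iff] at hz
  rw [abs_mul]
  have hi := (PiLp.norm_apply_le z i).trans hz.le
  have hj := (PiLp.norm_apply_le z j).trans hz.le
  rw [Real.norm_eq_abs] at hi hj
  exact mul_le_mul hi hj (abs_nonneg _) ((abs_nonneg _).trans hi)

/-- The reflection of the i-th coordinate preserves k and changes the sign of the integrand. -/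
lemma integral_coord_mul_of_ne (hk : IsRadialKernel δ k) {i j : Fin d} (hij : i ≠ j) :
    ∫ z : Eu d, z i * z j * k z = 0 := by
  let L : Eu d ≃ₗᵢ[ℝ] Eu d := LinearIsometryEquiv.piLpCongrRight 2
    fun l => if l = i then LinearIsometryEquiv.neg ℝ else LinearIsometryEquiv.refl ℝ ℝ
  have h := L.measurePreserving.integral_comp L.toHomeomorph.measurableEmbedding
    fun z : Eu d => z i * z j * k z
  have h2 : ∀ z : Eu d, L z i * L z j * k (L z) = -(z i * z j * k z) := by
    intro z
    have hi : L z i = - z i := by simp [L]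
    have hj : L z j = z j := by simp [L, hij.symm]
    rw [hi, hj, hk.radial (L z) z (L.norm_map z)]; ring
  simp_rw [h2, integral_neg] at h
  linarith

/-- Exchanging two coordinates is an isometry. As the d equal diagonal moments add up to d, each of
them is 1. -/
lemma integral_coord_sq_mul_eq (hk : IsRadialKernel δ k) (i j : Fin d) :
    ∫ z : Eu d, z i * z i * k z = ∫ z : Eu d, z j * z j * k z := by
  let L : Eu d ≃ₗᵢ[ℝ] Eu d := LinearIsometryEquiv.piLpCongrLeft 2 ℝ ℝ (Equiv.swap i j)
  have h := L.measurePreserving.integral_comp L.toHomeomorph.measurableEmbedding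
    fun z : Eu d => z j * z j * k z
  rw [← h]
  refine integral_congr_ae (Eventually.of_forall fun z => ?_)
  have hi : L z j = z i := by simp [L, Equiv.piCongrLeft'_apply]
  simp only
  rw [hi, hk.radial (L z) z (L.norm_map z)]

lemma integral_coord_mul (hk : IsRadialKernel δ k) (i j : Fin d) :
    ∫ z : Eu d, z i * z j * k z = if i = j then 1 else 0 := by
  split_ifs with h
  · subst h
    have h1 : ∑ j : Fin d, ∫ z : Eu d, z j * z j * k z = d := by
      rw [← integral_finsetSum _ fun j _ => hk.integrable_coord_mul j j, ← hk.moment]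
      refine integral_congr_ae (Eventually.of_forall fun z => ?_)
      simp only
      rw [← Finset.sum_mul, EuclideanSpace.norm_sq_eq]
      simp [pow_two]
    rw [Finset.sum_congr rfl fun j _ => hk.integral_coord_sq_mul_eq j i] at h1
    have hd : (d : ℝ) ≠ 0 := by
      have := i.pos
      positivity
    simp only [Finset.sum_const, Finset.card_univ, Fintype.card_fin, nsmul_eq_mul] at h1
    exact mul_left_cancel₀ hd (by rw [h1, mul_one])
  · exact hk.integral_coord_mul_of_ne h

/-- Since the second moment matrix of k is the identity, integrating a quadratic form against k
returns its trace; for the second derivative of a function this is the Laplacian. -/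
lemma integral_bilin_mul (hk : IsRadialKernel δ k)
    (A : ContinuousMultilinearMap ℝ (fun _ : Fin 2 => Eu d) ℝ) :
    Integrable (fun z => (A fun _ => z) * k z) ∧
    ∫ z, (A fun _ => z) * k z
      = ∑ i, A fun _ => EuclideanSpace.basisFun (Fin d) ℝ i := by
  set b := EuclideanSpace.basisFun (Fin d) ℝ
  have hA : ∀ z : Eu d, (A fun _ => z) = ∑ r : Fin 2 → Fin d, (z (r 0) * z (r 1)) *
      A fun l => b (r l) := by
    intro z
    have hz : z = ∑ i, z i • b i := by
      simpa [b] using (b.sum_repr z).symm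
    conv_lhs => rw [hz]
    rw [A.map_sum]
    refine Finset.sum_congr rfl fun r _ => ?_
    rw [A.map_smul_univ (fun l => z (r l)) fun l => b (r l)]
    simp [Fin.prod_univ_two]
  have hI : ∀ r : Fin 2 → Fin d,
      Integrable fun z : Eu d => (A fun l => b (r l)) * (z (r 0) * z (r 1) * k z) :=
    fun r => (hk.integrable_coord_mul _ _).const_mul _
  have hE : ∀ z : Eu d, (A fun _ => z) * k z
      = ∑ r : Fin 2 → Fin d, (A fun l => b (r l)) * (z (r 0) * z (r 1) * k z) := by
    intro z
    rw [hA, Finset.sum_mul]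
    exact Finset.sum_congr rfl fun r _ => by ring
  simp_rw [hE]
  refine ⟨integrable_finsetSum _ fun r _ => hI r, ?_⟩
  rw [integral_finsetSum _ fun r _ => hI r]
  simp_rw [integral_const_mul, hk.integral_coord_mul]
  rw [← (finTwoArrowEquiv (Fin d)).symm.sum_comp, Fintype.sum_prod_type]
  refine Finset.sum_congr rfl fun i _ => ?_
  rw [Finset.sum_eq_single i]
  · simp only [finTwoArrowEquiv_symm_apply, Matrix.cons_val_zero, Matrix.cons_val_one, if_true,
      mul_one]
    congr 1
    ext l
    fin_cases l <;> rfl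
  · intro j _ hj
    simp [hj.symm]
  · simp

/-- Consistency of the nonlocal operator with the Laplacian. -/
lemma abs_integral_sub_laplacian_le (hk : IsRadialKernel δ k) (hδ : 0 < δ) {f : Eu d → ℝ}
    {D E : Set (Eu d)} (hD : IsOpen D) (hED : E ⊆ D)
    (hf : ContDiffOn ℝ (4 : ℕ) f D) {M M₀ : ℝ}
    (hM : ∀ x ∈ D, ‖iteratedFDerivWithin ℝ 4 f D x‖ ≤ M) (hM₀ : ∀ x ∈ D, |f x| ≤ M₀)
    {x : Eu d} (hx : Metric.ball x δ ⊆ E) :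
    |2 * (∫ y in E, (f y - f x) * k (y - x)) - Laplacian.laplacian f x| ≤ 2 * M * d * δ ^ 2 := by
  have hxE : ∀ z : Eu d, ‖z‖ < δ → x + z ∈ D := fun z hz =>
    hED (hx (by simpa [Metric.mem_ball, dist_eq_norm] using hz))
  have hxD : x ∈ D := by simpa using hxE 0 (by simpa using hδ)
  have hM0 : 0 ≤ M := (norm_nonneg _).trans (hM x hxD)
  have hG : Integrable fun z => (f (x + z) - f x) * k z := by
    refine hk.integrable_mul (C := M₀ + M₀) ?_ fun z hz => ?_
    · refine ContinuousOn.sub ?_ continuousOn_const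
      exact hf.continuousOn.comp (by fun_prop) fun z hz => hxE z (by simpa using hz)
    · exact (abs_sub _ _).trans (add_le_add (hM₀ _ (hxE z (by simpa using hz))) (hM₀ x hxD))
  have h1 : ∫ y in E, (f y - f x) * k (y - x) = ∫ z, (f (x + z) - f x) * k z := by
    rw [setIntegral_eq_integral_of_forall_compl_eq_zero,
      ← integral_add_left_eq_self (fun y => (f y - f x) * k (y - x)) x]
    · simp
    · intro y hy
      rw [hk.support, mul_zero]
      by_contra h
      exact hy (hx (by simpa [Metric.mem_ball, dist_eq_norm] using h))
  -- The factor 2 in the operator pays for averaging over z and -z, which turns first differences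
  -- into second differences.
  have h2 : 2 * ∫ z, (f (x + z) - f x) * k z
      = ∫ z, (f (x + z) - f x + (f (x - z) - f x)) * k z := by
    have hneg := integral_neg_eq_self (fun z => (f (x + z) - f x) * k z) volume
    have hG' := hG.comp_neg
    rw [two_mul]
    nth_rw 2 [← hneg]
    rw [← integral_add hG hG']
    refine integral_congr_ae (Eventually.of_forall fun z => ?_)
    simp only [hk.even, ← sub_eq_add_neg]; ring
  have h2I : Integrable fun z => (f (x + z) - f x + (f (x - z) - f x)) * k z := by
    refine (hG.add hG.comp_neg).congr (Eventually.of_forall fun z => ?_)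
    simp only [Pi.add_apply, hk.even, ← sub_eq_add_neg]; ring
  obtain ⟨hAI, hA⟩ := hk.integral_bilin_mul (iteratedFDeriv ℝ 2 f x)
  have h3 : Laplacian.laplacian f x = ∫ z, (iteratedFDeriv ℝ 2 f x fun _ => z) * k z := by
    rw [hA, InnerProductSpace.laplacian_eq_iteratedFDeriv_orthonormalBasis f
      (EuclideanSpace.basisFun (Fin d) ℝ)]
    refine Finset.sum_congr rfl fun i _ => ?_
    congr 1
    ext l
    fin_cases l <;> rfl
  rw [h1, h2, h3, ← integral_sub h2I hAI]
  have hbound : ∀ z : Eu d, ‖(f (x + z) - f x + (f (x - z) - f x)) * k z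
      - (iteratedFDeriv ℝ 2 f x fun _ => z) * k z‖ ≤ 2 * M * δ ^ 2 * (‖z‖ ^ 2 * k z) := by
    intro z
    by_cases hz : δ ≤ ‖z‖
    · simp [hk.support z hz]
    · rw [not_le] at hz
      have hT := abs_second_difference_sub_le hD hf hM (x := x) (z := z) fun t ht => by
        refine hxE _ ?_
        rw [norm_smul]
        refine lt_of_le_of_lt (mul_le_of_le_one_left (norm_nonneg _) ?_) hz
        exact abs_le.2 ht
      rw [← sub_mul, norm_mul, Real.norm_eq_abs, Real.norm_eq_abs, abs_of_nonneg (hk.nonneg z)]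
      -- Of the four powers of ‖z‖, two are bounded by δ² and two are kept for the second moment, so
      -- the error is O(δ²) whatever the profile of k.
      calc _ ≤ 2 * M * ‖z‖ ^ 4 * k z := mul_le_mul_of_nonneg_right hT (hk.nonneg z)
        _ = 2 * M * ‖z‖ ^ 2 * (‖z‖ ^ 2 * k z) := by ring
        _ ≤ _ := by
          have := hk.nonneg z
          gcongr
  have := norm_integral_le_of_norm_le (hk.integrable_sq_mul.const_mul (2 * M * δ ^ 2))
    (Eventually.of_forall hbound)
  rw [integral_const_mul, hk.moment, Real.norm_eq_abs] at this
  exact this.trans (le_of_eq (by ring))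

lemma one_le_lintegral_moment (hk : IsRadialKernel δ k) (hd : 1 ≤ d) :
    1 ≤ ∫⁻ z : Eu d, ENNReal.ofReal (k z) * ENNReal.ofReal ‖z‖ ^ 2 := by
  have h : ∫⁻ z : Eu d, ENNReal.ofReal (k z) * ENNReal.ofReal ‖z‖ ^ 2
      = ENNReal.ofReal d := by
    rw [← hk.moment, ofReal_integral_eq_lintegral_ofReal hk.integrable_sq_mul
      (Eventually.of_forall fun z => mul_nonneg (by positivity) (hk.nonneg z))]
    refine lintegral_congr fun z => ?_
    rw [ENNReal.ofReal_mul (by positivity), ENNReal.ofReal_pow (norm_nonneg _), mul_comm]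
  rw [h]
  simpa using hd

end IsRadialKernel

/-- Finite range is assumed only at points of Ω. One such point forces the profile to vanish on [δ,
∞), as every such number is a norm when d ≥ 1, and radiality then gives finite range everywhere.
Integrability and the moment are read off in polar coordinates. -/
lemma IsKernel.exists_isRadialKernel {Ω : Set (Eu d)} {δ : ℝ} {γ : Eu d → Eu d → ℝ}
    (hγ : IsKernel Ω δ γ) (hd : 1 ≤ d) (hδ : 0 < δ) (hΩ : Ω.Nonempty) :
    ∃ k : Eu d → ℝ, IsRadialKernel δ k ∧ ∀ x y, γ x y = k (y - x) := by
  obtain ⟨ρ, hρ, -, hint, hmom⟩ := hγ.radial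
  obtain ⟨x₀, hx₀⟩ := hΩ
  have : Nontrivial (Eu d) := by
    have : Nonempty (Fin d) := ⟨⟨0, hd⟩⟩
    infer_instance
  have hdim : Module.finrank ℝ (Eu d) = d := by simp
  have hsupp : ∀ z : Eu d, δ ≤ ‖z‖ → ρ ‖z‖ = 0 := by
    intro z hz
    have := hγ.finite_range x₀ hx₀ (x₀ + z) (by simpa [Metric.mem_ball, dist_eq_norm] using hz)
    rwa [hρ, add_sub_cancel_left] at this
  have hsupp' : ∀ s : ℝ, δ ≤ s → ρ s = 0 := by
    intro s hs
    obtain ⟨z, hz⟩ := exists_norm_eq (Eu d) (hδ.le.trans hs)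
    rw [← hz]
    exact hsupp z (hz ▸ hs)
  refine ⟨fun z => ρ ‖z‖, ⟨?_, fun z => ?_, fun z z' h => by rw [h], hsupp, ?_⟩, hρ⟩
  · have h1 : IntegrableOn (fun z : Eu d => ρ ‖z‖) (Metric.ball 0 δ) := by
      rw [integrableOn_fun_norm_addHaar volume]
      refine Integrable.bdd_mul (c := δ ^ (Module.finrank ℝ (Eu d) - 1)) hint
        (by fun_prop) ((ae_restrict_iff' measurableSet_Ioo).2 (Eventually.of_forall fun s hs => ?_))
      rw [Real.norm_eq_abs, abs_of_nonneg (pow_nonneg hs.1.le _)]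
      exact pow_le_pow_left₀ hs.1.le hs.2.le _
    refine (integrableOn_iff_integrable_of_support_subset fun z hz => ?_).1 h1
    by_contra h
    rw [mem_ball_zero_iff, not_lt] at h
    exact hz (hsupp z h)
  · have := hγ.nonneg 0 z
    rwa [hρ, sub_zero] at this
  · have h := integral_fun_norm_addHaar (volume : Measure (Eu d)) fun s => s ^ 2 * ρ s
    rw [h, ← hmom, Measure.toSphere_real_apply_univ, nsmul_eq_mul, smul_eq_mul, mul_assoc]
    congr 2
    rw [hdim, ← setIntegral_eq_of_subset_of_forall_sdiff_eq_zero measurableSet_Ioi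
      (s := Ioo 0 δ) (fun s hs => hs.1)]
    · refine setIntegral_congr_fun measurableSet_Ioi fun s _ => ?_
      obtain ⟨n, rfl⟩ : ∃ n, d = n + 1 := ⟨d - 1, by omega⟩
      simp only [add_tsub_cancel_right, smul_eq_mul]
      ring
    · intro s hs
      rw [hsupp', mul_zero]
      by_contra h
      exact hs.2 ⟨hs.1, not_le.1 h⟩

end NonlocalCDG

/-! ### Volume of the interaction domain -/

namespace NonlocalCDG

variable {d : ℕ}

/-- Packing argument: about 1/δ disjoint translates of the slab, by multiples of 2δ in the normal
direction, fit into a ball whose radius does not depend on δ. -/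
lemma volume_slab_le (n : Eu d) (hn : ‖n‖ = 1) (b R : ℝ) {δ δ₀ : ℝ} (hδ : 0 < δ) (hδ₀ : δ ≤ δ₀) :
    volume {x : Eu d | ‖x‖ < R ∧ |inner ℝ n x - b| < δ}
      ≤ ENNReal.ofReal δ * volume (Metric.ball (0 : Eu d) (R + 2 * (1 + δ₀))) := by
  set S := {x : Eu d | ‖x‖ < R ∧ |inner ℝ n x - b| < δ} with hS
  have hSm : MeasurableSet S := by
    refine IsOpen.measurableSet (IsOpen.inter ?_ ?_)
    · exact isOpen_lt (f := fun x : Eu d => ‖x‖) (by fun_prop) continuous_const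
    · exact isOpen_lt (f := fun x : Eu d => |inner ℝ n x - b|) (by fun_prop) continuous_const
  set N := ⌈1 / δ⌉₊
  have hN1 : 1 ≤ N * δ := by
    have := Nat.le_ceil (1 / δ)
    rwa [div_le_iff₀ hδ] at this
  have hN2 : N * δ ≤ 1 + δ := by
    have := (Nat.ceil_lt_add_one (by positivity : 0 ≤ 1 / δ)).le
    calc N * δ ≤ (1 / δ + 1) * δ := by gcongr
      _ = 1 + δ := by field_simp
  set T : ℕ → Set (Eu d) := fun j => (fun x => x + (-(2 * j * δ)) • n) ⁻¹' S
  have hTm : ∀ j, MeasurableSet (T j) := fun j => (measurable_add_const _) hSm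
  have hTv : ∀ j, volume (T j) = volume S := fun j => measure_preimage_add_right _ _ _
  have hTmem : ∀ j x, x ∈ T j → ‖x‖ < R + 2 * j * δ ∧ |inner ℝ n x - 2 * j * δ - b| < δ := by
    intro j x hx
    obtain ⟨h1, h2⟩ := hx
    constructor
    · have h3 : ‖x‖ ≤ ‖x + (-(2 * j * δ)) • n‖ + ‖(2 * j * δ) • n‖ := by
        refine le_trans (le_of_eq ?_) (norm_add_le _ _)
        rw [neg_smul, neg_add_cancel_right]
      rw [norm_smul, hn, mul_one, Real.norm_eq_abs, abs_of_nonneg (by positivity)] at h3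
      linarith
    · rw [inner_add_right, inner_smul_right, real_inner_self_eq_norm_sq, hn] at h2
      refine lt_of_eq_of_lt ?_ h2
      congr 1; ring
  have hdisj : (↑(Finset.range N) : Set ℕ).PairwiseDisjoint T := by
    intro i _ j _ hij
    refine Set.disjoint_left.2 fun x hi hj => ?_
    have h1 := abs_lt.1 (hTmem i x hi).2
    have h2 := abs_lt.1 (hTmem j x hj).2
    rcases lt_or_gt_of_ne hij with h | h
    · have : (i : ℝ) + 1 ≤ j := by exact_mod_cast h
      nlinarith
    · have : (j : ℝ) + 1 ≤ i := by exact_mod_cast h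
      nlinarith
  have hsum : N * volume S ≤ volume (Metric.ball (0 : Eu d) (R + 2 * (1 + δ₀))) := by
    calc N * volume S = ∑ j ∈ Finset.range N, volume (T j) := by simp [hTv]
      _ = volume (⋃ j ∈ Finset.range N, T j) :=
        (measure_biUnion_finset hdisj fun j _ => hTm j).symm
      _ ≤ _ := by
        refine measure_mono (iUnion₂_subset fun j hj x hx => ?_)
        rw [mem_ball_zero_iff]
        have h1 := (hTmem j x hx).1
        have h2 : (j : ℝ) ≤ N := by exact_mod_cast (Finset.mem_range.1 hj).le
        nlinarith
  calc volume S ≤ ENNReal.ofReal (N * δ) * volume S :=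
        le_mul_of_one_le_left zero_le (ENNReal.one_le_ofReal.2 hN1)
    _ = ENNReal.ofReal δ * (N * volume S) := by
        rw [ENNReal.ofReal_mul (by positivity), ENNReal.ofReal_natCast]; ring
    _ ≤ _ := by gcongr

/-- The interaction domain of a polyhedron has volume `O(δ)`. -/
lemma IsBoundedOpenPolyhedron.exists_volume_interactionDomain_le {Ω : Set (Eu d)}
    (hΩ : IsBoundedOpenPolyhedron Ω) (δ₀ : ℝ) :
    ∃ C : ℝ, 0 ≤ C ∧ ∀ δ ∈ Ioc 0 δ₀,
      volume (interactionDomain Ω δ) ≤ ENNReal.ofReal (C * δ) := by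
  obtain ⟨-, hb, H, hH, hfr⟩ := hΩ
  obtain ⟨R, hR⟩ := (Metric.isBounded_closure_of_isBounded hb).exists_norm_le
  set V := volume (Metric.ball (0 : Eu d) (R + δ₀ + 2 * (1 + δ₀)))
  have hV : V ≠ ∞ := measure_ball_lt_top.ne
  refine ⟨H.card * V.toReal, by positivity, fun δ hδ => ?_⟩
  -- A point closer than δ to the boundary is closer than δ to one of the hyperplanes; dividing by
  -- the norm of the normal vector turns the linear form into a signed distance.
  have hsub : interactionDomain Ω δ ⊆ ⋃ p ∈ H,
      {x : Eu d | ‖x‖ < R + δ₀ ∧ |inner ℝ (‖p.1‖⁻¹ • p.1) x - ‖p.1‖⁻¹ * p.2| < δ} := by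
    rintro y ⟨-, hy⟩
    obtain ⟨x, hx, hxy⟩ := Metric.mem_thickening_iff.1 hy
    obtain ⟨p, hp, hpx⟩ := mem_iUnion₂.1 (hfr hx)
    have hxR := hR x (frontier_subset_closure hx)
    rw [dist_eq_norm] at hxy
    refine mem_iUnion₂.2 ⟨p, hp, ?_, ?_⟩
    · have := norm_add_le (y - x) x
      rw [sub_add_cancel] at this
      linarith [hδ.2]
    · have hpx' : inner ℝ p.1 x = p.2 := hpx
      rw [← hpx', ← real_inner_smul_left, ← inner_sub_right]
      refine (abs_real_inner_le_norm _ _).trans_lt ?_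
      rwa [norm_smul, norm_inv, norm_norm, inv_mul_cancel₀ (norm_ne_zero_iff.2 (hH p hp)), one_mul]
  calc volume (interactionDomain Ω δ)
      ≤ ∑ p ∈ H, volume {x : Eu d | ‖x‖ < R + δ₀ ∧
          |inner ℝ (‖p.1‖⁻¹ • p.1) x - ‖p.1‖⁻¹ * p.2| < δ} :=
        (measure_mono hsub).trans (measure_biUnion_finset_le _ _)
    _ ≤ ∑ _p ∈ H, ENNReal.ofReal δ * V := by
        refine Finset.sum_le_sum fun p hp => volume_slab_le _ ?_ _ _ hδ.1 hδ.2
        rw [norm_smul, norm_inv, norm_norm, inv_mul_cancel₀ (norm_ne_zero_iff.2 (hH p hp))]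
    _ = ENNReal.ofReal (H.card * V.toReal * δ) := by
        rw [Finset.sum_const, nsmul_eq_mul, ENNReal.ofReal_mul (by positivity),
          ENNReal.ofReal_mul (by positivity), ENNReal.ofReal_natCast, ENNReal.ofReal_toReal hV]
        ring

/-! ### Piecewise linear interpolation -/

/-- Extend the vertices to an affine basis of the space and combine its barycentric coordinates with
the values of f as weights. -/
lemma exists_affineMap_eqOn {s : Set (Eu d)} (hs : AffineIndependent ℝ ((↑) : s → Eu d))
    (f : Eu d → ℝ) : ∃ A : Eu d →ᵃ[ℝ] ℝ, ∀ v ∈ s, A v = f v := by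
  obtain ⟨t, hst, ht, htop⟩ := exists_subset_affineIndependent_affineSpan_eq_top hs
  have : Fintype t := (finite_set_of_fin_dim_affineIndependent ℝ ht).fintype
  let b : AffineBasis t ℝ (Eu d) := ⟨(↑), ht, by rw [Subtype.range_coe]; exact htop⟩
  have hsum : ∀ (I : Finset t) (x : Eu d),
      (∑ i ∈ I, f i • b.coord i : Eu d →ᵃ[ℝ] ℝ) x = ∑ i ∈ I, f i * b.coord i x := by
    classical
    intro I x
    induction I using Finset.induction_on with
    | empty => simp
    | insert i I hi ih => rw [Finset.sum_insert hi, Finset.sum_insert hi, ← ih]; rfl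
  refine ⟨∑ i : t, f i • b.coord i, fun v hv => ?_⟩
  rw [hsum, Finset.sum_eq_single ⟨v, hst hv⟩]
  · have : b.coord ⟨v, hst hv⟩ v = 1 := b.coord_apply_eq ⟨v, hst hv⟩
    rw [this, mul_one]
  · intro i _ hi
    have : b.coord i v = 0 := b.coord_apply_ne (j := ⟨v, hst hv⟩) hi
    rw [this, mul_zero]
  · simp

/-- Nodal interpolation by continuous piecewise linear functions. -/
lemma exists_interpolant {K : Geometry.SimplicialComplex ℝ (Eu d)} {h : ℝ} (hK : IsMesh K h)
    {f : Eu d → ℝ} {D : Set (Eu d)} (hD : IsOpen D) (hKD : K.space ⊆ D)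
    (hf : ContDiffOn ℝ (2 : ℕ) f D) {M : ℝ}
    (hM : ∀ x ∈ D, ‖iteratedFDerivWithin ℝ 2 f D x‖ ≤ M) :
    ∃ p, IsPiecewiseLinear K p ∧ ∀ x ∈ K.space, |p x - f x| ≤ M * h ^ 2 := by
  classical
  have hA : ∀ s : K.faces, ∃ A : Eu d →ᵃ[ℝ] ℝ, ∀ v ∈ (s : Finset (Eu d)), A v = f v :=
    fun s => exists_affineMap_eqOn (s := ((s : Finset (Eu d)) : Set (Eu d))) (K.indep s.2) f
  choose A hA using hA
  -- Two elements meet within the hull of their common vertices, where both affine maps interpolate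
  -- the same values; this makes the glued function well defined.
  have hagree : ∀ (s t : K.faces) (x : Eu d), x ∈ convexHull ℝ ((s : Finset (Eu d)) : Set (Eu d)) →
      x ∈ convexHull ℝ ((t : Finset (Eu d)) : Set (Eu d)) → A s x = A t x := by
    intro s t x hs ht
    have hx := K.inter_subset_convexHull s.2 t.2 ⟨hs, ht⟩
    have hconv : Convex ℝ ((A s - A t) ⁻¹' {0}) := (convex_singleton 0).affine_preimage _
    have hsub := convexHull_min (fun v hv => ?_) hconv hx
    · exact sub_eq_zero.1 hsub
    · exact sub_eq_zero.2 ((hA s v hv.1).trans (hA t v hv.2).symm)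
  have hsp : ∀ x, x ∈ K.space → ∃ s : K.faces,
      x ∈ convexHull ℝ ((s : Finset (Eu d)) : Set (Eu d)) := fun x hx => by
    obtain ⟨s, hs, hxs⟩ := Geometry.SimplicialComplex.mem_space_iff.1 hx
    exact ⟨⟨s, hs⟩, hxs⟩
  let p : Eu d → ℝ := fun x => if hx : x ∈ K.space then A (hsp x hx).choose x else 0
  have hp : ∀ (s : K.faces) (x : Eu d), x ∈ convexHull ℝ ((s : Finset (Eu d)) : Set (Eu d)) →
      p x = A s x := by
    intro s x hx
    have hxK : x ∈ K.space := Geometry.SimplicialComplex.convexHull_subset_space s.2 hx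
    simp only [p, dif_pos hxK]
    exact hagree _ _ x (hsp x hxK).choose_spec hx
  have hfin : Finite K.faces := hK.finite
  refine ⟨p, ⟨?_, fun s hs => ⟨A ⟨s, hs⟩, fun x hx => hp ⟨s, hs⟩ x hx⟩⟩, ?_⟩
  · have hU : K.space = ⋃ s : K.faces, convexHull ℝ ((s : Finset (Eu d)) : Set (Eu d)) := by
      rw [Geometry.SimplicialComplex.space, biUnion_eq_iUnion]
    rw [hU]
    refine (locallyFinite_of_finite _).continuousOn_iUnion (fun s => ?_) fun s => ?_
    · exact ((s : Finset (Eu d)).finite_toSet.isCompact_convexHull (𝕜 := ℝ)).isClosed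
    · exact ((A s).continuous_of_finiteDimensional.continuousOn).congr fun x hx => hp s x hx
  · intro x hx
    obtain ⟨s, hs⟩ := hsp x hx
    rw [hp s x hs]
    set L := fderiv ℝ f x
    have hbdd : Bornology.IsBounded (convexHull ℝ ((s : Finset (Eu d)) : Set (Eu d))) :=
      ((s : Finset (Eu d)).finite_toSet.isCompact_convexHull (𝕜 := ℝ)).isBounded
    have hMnn : 0 ≤ M := (norm_nonneg _).trans (hM x (hKD hx))
    -- Subtract the linear map L = Df(x), x being the evaluation point. At each vertex the
    -- difference is f(v) - L v, within M h² of f(x) - L x by Taylor; being affine, it stays in that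
    -- interval on the whole element.
    have hconv : Convex ℝ ((A s - (L : Eu d →ₗ[ℝ] ℝ).toAffineMap) ⁻¹'
        Icc (f x - L x - M * h ^ 2) (f x - L x + M * h ^ 2)) :=
      (convex_Icc _ _).affine_preimage _
    have hmem := convexHull_min (fun v hv => ?_) hconv hs
    · have h1 : f x - L x - M * h ^ 2 ≤ A s x - L x := hmem.1
      have h2 : A s x - L x ≤ f x - L x + M * h ^ 2 := hmem.2
      exact abs_le.2 ⟨by linarith, by linarith⟩
    · have hv' := subset_convexHull ℝ _ hv
      have hT := abs_sub_sub_iteratedFDeriv_le hD hf hM (x := x) (z := v - x) fun t ht =>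
        hKD (Geometry.SimplicialComplex.convexHull_subset_space s.2
          ((convex_convexHull ℝ _).add_smul_sub_mem hs hv' ht))
      have hd : ‖v - x‖ ≤ h := by
        rw [← dist_eq_norm]
        exact (Metric.dist_le_diam_of_mem hbdd hv' hs).trans (hK.diam_le s s.2)
      have hq : M * ‖v - x‖ ^ 2 ≤ M * h ^ 2 := by gcongr
      rw [add_sub_cancel, map_sub] at hT
      have h3 := abs_le.1 (hT.trans hq)
      have h4 : (A s - (L : Eu d →ₗ[ℝ] ℝ).toAffineMap) v = f v - L v := by
        rw [← hA s v hv]; rfl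
      rw [mem_preimage, h4]
      constructor <;> linarith [h3.1, h3.2]

end NonlocalCDG

/-! ### Geometry of the extended domain -/

namespace NonlocalCDG

variable {d : ℕ} {Ω : Set (Eu d)} {δ : ℝ}

section Geometry

lemma extendedDomain_eq (Ω : Set (Eu d)) (δ : ℝ) :
    extendedDomain Ω δ = Ω ∪ Metric.thickening δ (frontier Ω) := by
  ext y
  simp only [extendedDomain, interactionDomain, mem_union, mem_ofPred_eq]
  tauto

lemma isOpen_extendedDomain (hΩ : IsOpen Ω) (δ : ℝ) : IsOpen (extendedDomain Ω δ) := by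
  rw [extendedDomain_eq]
  exact hΩ.union Metric.isOpen_thickening

lemma extendedDomain_mono (Ω : Set (Eu d)) {δ δ' : ℝ} (h : δ ≤ δ') :
    extendedDomain Ω δ ⊆ extendedDomain Ω δ' := by
  rw [extendedDomain_eq, extendedDomain_eq]
  exact union_subset_union_right _ (Metric.thickening_mono h _)

lemma isBounded_extendedDomain (hΩ : Bornology.IsBounded Ω) (δ : ℝ) :
    Bornology.IsBounded (extendedDomain Ω δ) := by
  rw [extendedDomain_eq]
  refine hΩ.union (Bornology.IsBounded.thickening ?_)
  exact (Metric.isBounded_closure_of_isBounded hΩ).subset frontier_subset_closure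

lemma subset_extendedDomain : Ω ⊆ extendedDomain Ω δ := subset_union_left

lemma closure_subset_extendedDomain (hδ : 0 < δ) : closure Ω ⊆ extendedDomain Ω δ := by
  rw [extendedDomain_eq, closure_eq_self_union_frontier]
  exact union_subset_union_right _ (Metric.self_subset_thickening hδ _)

lemma measurableSet_interactionDomain (hΩ : IsOpen Ω) (δ : ℝ) :
    MeasurableSet (interactionDomain Ω δ) :=
  hΩ.measurableSet.compl.inter Metric.isOpen_thickening.measurableSet

lemma interactionDomain_subset : interactionDomain Ω δ ⊆ extendedDomain Ω δ :=
  subset_union_right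

lemma disjoint_interactionDomain : Disjoint Ω (interactionDomain Ω δ) :=
  disjoint_left.2 fun _ h h' => h'.1 h

/-- By connectedness, the segment from x in Ω to y outside crosses the boundary, at a point no
farther from y than x is. So points of Ω interact with nothing beyond the extended domain. -/
lemma ball_subset_extendedDomain {x : Eu d} (hx : x ∈ Ω) :
    Metric.ball x δ ⊆ extendedDomain Ω δ := by
  intro y hy
  by_cases hyΩ : y ∈ Ω
  · exact Or.inl hyΩ
  · obtain ⟨z, hz, hzf⟩ : (segment ℝ x y ∩ frontier Ω).Nonempty := by
      by_contra hne
      have hnf : ∀ z ∈ segment ℝ x y, z ∉ frontier Ω := fun z hz hf => hne ⟨z, hz, hf⟩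
      have hx' := left_mem_segment ℝ x y
      have hy' := right_mem_segment ℝ x y
      obtain ⟨z, -, h1, h2⟩ := (convex_segment x y).isPreconnected (interior Ω) (closure Ω)ᶜ
        isOpen_interior isClosed_closure.isOpen_compl
        (fun z hz => by
          by_contra h
          simp only [mem_union, mem_compl_iff, not_or, not_not] at h
          exact hnf z hz ⟨h.2, h.1⟩)
        ⟨x, hx', by_contra fun h => hnf x hx' ⟨subset_closure hx, h⟩⟩
        ⟨y, hy', fun h => hnf y hy' ⟨h, fun h' => hyΩ (interior_subset h')⟩⟩
      exact h2 (interior_subset_closure h1)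
    refine Or.inr ⟨hyΩ, Metric.mem_thickening_iff.2 ⟨z, hzf, ?_⟩⟩
    have := dist_add_dist_of_mem_segment hz
    rw [Metric.mem_ball, dist_comm] at hy
    rw [dist_comm]
    linarith [dist_nonneg (x := x) (y := z)]

end Geometry

/-! ### Cauchy–Schwarz, L² bounds and the Poincaré inequality for increments -/

section Norms

lemma abs_integral_mul_le {α : Type*} [MeasurableSpace α] {ν : Measure α} {F e : α → ℝ}
    (hF : MemLp F 2 ν) (he : MemLp e 2 ν) :
    |∫ x, F x * e x ∂ν| ≤ (eLpNorm F 2 ν).toReal * (eLpNorm e 2 ν).toReal := by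
  have h : inner ℝ hF.toLp he.toLp = ∫ x, F x * e x ∂ν := by
    rw [L2.inner_def]
    refine integral_congr_ae ?_
    filter_upwards [hF.coeFn_toLp, he.coeFn_toLp] with x h1 h2
    rw [h1, h2]
    simp [mul_comm]
  rw [← h, ← Lp.norm_toLp F hF, ← Lp.norm_toLp e he]
  exact abs_real_inner_le_norm _ _

lemma eLpNorm_two_le_of_ae_bound {α : Type*} [MeasurableSpace α] {ν : Measure α} {V B : ℝ}
    (hV : ν univ ≤ ENNReal.ofReal V) {φ : α → ℝ} (hφ : ∀ᵐ x ∂ν, |φ x| ≤ B) :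
    eLpNorm φ 2 ν ≤ ENNReal.ofReal (√V * B) := by
  refine (eLpNorm_le_of_ae_bound (p := 2) (C := B) hφ).trans ?_
  rw [ENNReal.ofReal_mul (Real.sqrt_nonneg _), Real.sqrt_eq_rpow]
  gcongr
  rcases le_or_gt V 0 with h | h
  · rw [ENNReal.ofReal_of_nonpos h, nonpos_iff_eq_zero] at hV
    rw [hV]; simp
  · rw [← ENNReal.ofReal_rpow_of_pos h]
    simp only [ENNReal.toReal_ofNat, one_div]
    gcongr

variable {E : Set (Eu d)} {k : Eu d → ℝ}

lemma norm_incrementLp_le (hk : Integrable k) (hke : ∀ z, k (-z) = k z) {G B : ℝ}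
    (hB : 0 ≤ B) (hG : ∫⁻ z, ENNReal.ofReal (k z) ≤ ENNReal.ofReal G) {φ : Eu d → ℝ}
    (hφ : MemLp φ 2 (volume.restrict E))
    (hφB : eLpNorm φ 2 (volume.restrict E) ≤ ENNReal.ofReal B) :
    ‖incrementLp hk hke hφ‖ ≤ 2 * √G * B := by
  rw [norm_incrementLp]
  refine ENNReal.toReal_le_of_le_ofReal (by positivity) ?_
  refine (eLpNorm_increment_le hk hke hφ).trans ?_
  rw [mul_assoc, ENNReal.ofReal_mul two_pos.le, ENNReal.ofReal_mul (Real.sqrt_nonneg _),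
    Real.sqrt_eq_rpow, ENNReal.ofReal_ofNat]
  gcongr
  rcases le_or_gt G 0 with h | h
  · rw [ENNReal.ofReal_of_nonpos h, nonpos_iff_eq_zero] at hG
    rw [hG]; simp
  · rw [← ENNReal.ofReal_rpow_of_pos h]
    gcongr

lemma aestronglyMeasurable_of_support {φ : Eu d → ℝ} (hE : MeasurableSet E)
    (hφ : AEStronglyMeasurable φ (volume.restrict E)) (h0 : ∀ x ∉ E, φ x = 0) :
    AEStronglyMeasurable φ volume := by
  have : E.indicator φ = φ := by
    ext x
    by_cases hx : x ∈ E
    · rw [indicator_of_mem hx]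
    · rw [indicator_of_notMem hx, h0 x hx]
  rw [← this]
  exact (aestronglyMeasurable_indicator_iff hE).2 hφ

lemma IsRadialKernel.poincare (hk : IsRadialKernel δ k) (hd : 1 ≤ d) (hΩ : IsOpen Ω) {D : ℝ}
    (hD0 : 0 ≤ D) (hD : ∀ x ∈ Ω, ∀ y ∈ Ω, ‖y - x‖ ≤ D) {w : Eu d → ℝ}
    (hδ : 0 < δ) (hw : MemLp w 2 (volume.restrict (extendedDomain Ω δ))) (hw0 : ∀ x ∉ Ω, w x = 0) :
    eLpNorm w 2 volume
      ≤ ENNReal.ofReal ((D + δ) * ‖incrementLp hk.integrable hk.even hw‖) := by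
  have hE := (isOpen_extendedDomain hΩ δ).measurableSet
  rw [norm_incrementLp, ENNReal.ofReal_mul (by positivity),
    ENNReal.ofReal_toReal (memLp_increment hk.integrable hk.even hw).eLpNorm_lt_top.ne]
  exact nonlocal_poincare hk.aemeasurable hD0 hD hk.support hE
    (fun x hx => ball_subset_extendedDomain hx) subset_extendedDomain
    (hk.one_le_lintegral_moment hd)
    (aestronglyMeasurable_of_support hE hw.aestronglyMeasurable
      fun x hx => hw0 x fun h => hx (subset_extendedDomain h)) hw0

end Norms

/-! ### Weak forms of the nonlocal problem and of the CDG scheme -/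

section WeakForms

variable {γ : Eu d → Eu d → ℝ} {k : Eu d → ℝ} {f g u : Eu d → ℝ}

lemma IsRadialKernel.eq_zero_of_notMem_ball (hk : IsRadialKernel δ k) {x y : Eu d}
    (hy : y ∉ Metric.ball x δ) : k (y - x) = 0 :=
  hk.support _ (by simpa [Metric.mem_ball, dist_eq_norm] using hy)

lemma nonlocalOp_eq (hk : IsRadialKernel δ k) (hγ : ∀ x y, γ x y = k (y - x)) {x : Eu d}
    (hx : x ∈ Ω) (u : Eu d → ℝ) :
    nonlocalOp γ u x = 2 * ∫ y in extendedDomain Ω δ, (u y - u x) * k (y - x) := by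
  rw [nonlocalOp, setIntegral_eq_integral_of_forall_compl_eq_zero]
  · simp_rw [hγ]
  · intro y hy
    rw [hk.eq_zero_of_notMem_ball fun h => hy (ball_subset_extendedDomain hx h), mul_zero]

lemma SolvesNonlocal.weak_form (hu : SolvesNonlocal Ω δ γ f g u) (hΩ : IsOpen Ω)
    (hk : IsRadialKernel δ k) (hγ : ∀ x y, γ x y = k (y - x))
    {w : Eu d → ℝ} (hw : MemLp w 2 (volume.restrict (extendedDomain Ω δ)))
    (hw0 : ∀ x ∉ Ω, w x = 0) :
    inner ℝ (incrementLp hk.integrable hk.even hu.1.memLp) (incrementLp hk.integrable hk.even hw)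
      = ∫ x in Ω, f x * w x := by
  have hV : MemV Ω δ γ (fun _ => 0) w := by
    refine ⟨hw, ?_, ?_⟩
    · rw [energyNorm_eq hγ hk.aemeasurable hw.aestronglyMeasurable]
      exact (memLp_increment hk.integrable hk.even hw).eLpNorm_lt_top
    · exact (ae_restrict_iff' (measurableSet_interactionDomain hΩ δ)).2
        (Eventually.of_forall fun x hx => hw0 x hx.1)
  rw [← hu.2 w hV, ← nonlocal_green hk.integrable hk.nonneg hk.even
    (isOpen_extendedDomain hΩ δ).measurableSet subset_extendedDomain hu.1.memLp hw hw0,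
    neg_mul, neg_inj, ← integral_const_mul]
  refine setIntegral_congr_fun hΩ.measurableSet fun x hx => ?_
  beta_reduce
  rw [nonlocalOp_eq hk hγ hx]; ring

lemma memLp_indicator_of_continuousOn {A S K : Set (Eu d)} (hA : Bornology.IsBounded A)
    {p : Eu d → ℝ} (hS : MeasurableSet S) (hSK : S ⊆ K) (hK : IsCompact K)
    (hp : ContinuousOn p K) : MemLp (S.indicator p) 2 (volume.restrict A) := by
  obtain ⟨M, hM⟩ := hK.exists_bound_of_continuousOn hp
  have : IsFiniteMeasure (volume.restrict A) := ⟨by simpa using hA.measure_lt_top⟩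
  refine MemLp.of_bound (C := max M 0) ?_ (Eventually.of_forall fun x => ?_)
  · exact ((aestronglyMeasurable_indicator_iff hS).2
      ((hp.mono hSK).aestronglyMeasurable hS)).restrict
  · by_cases hx : x ∈ S
    · rw [indicator_of_mem hx]; exact (hM x (hSK hx)).trans (le_max_left _ _)
    · rw [indicator_of_notMem hx]; simp

lemma IsMesh.isCompact_space {K : Geometry.SimplicialComplex ℝ (Eu d)} {h : ℝ}
    (hK : IsMesh K h) : IsCompact K.space :=
  hK.finite.isCompact_biUnion fun s _ => s.finite_toSet.isCompact_convexHull (𝕜 := ℝ)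

lemma memLp_of_mem_discreteV0 (hΩ : IsOpen Ω) (hb : Bornology.IsBounded Ω)
    {K : Geometry.SimplicialComplex ℝ (Eu d)} {h : ℝ} (hK : IsMeshOfDomain Ω K h)
    {v : Eu d → ℝ} (hv : v ∈ discreteV0 Ω K) (δ : ℝ) :
    MemLp v 2 (volume.restrict (extendedDomain Ω δ)) := by
  obtain ⟨p, hp, rfl⟩ := hv
  exact memLp_indicator_of_continuousOn (isBounded_extendedDomain hb δ) hΩ.measurableSet
    (hK.space_eq ▸ subset_closure) hK.isCompact_space hp.continuousOn

lemma memLp_of_mem_discreteVc (hΩ : IsOpen Ω) (hb : Bornology.IsBounded Ω)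
    {K : Geometry.SimplicialComplex ℝ (Eu d)} {h : ℝ} (hK : IsMeshOfInteraction Ω δ K h)
    {v : Eu d → ℝ} (hv : v ∈ discreteVc Ω δ K) :
    MemLp v 2 (volume.restrict (extendedDomain Ω δ)) := by
  obtain ⟨p, hp, rfl⟩ := hv
  exact memLp_indicator_of_continuousOn (isBounded_extendedDomain hb δ)
    (measurableSet_interactionDomain hΩ δ) hK.covers hK.isCompact_space hp.continuousOn

lemma eq_zero_of_mem_discreteV0 {K : Geometry.SimplicialComplex ℝ (Eu d)} {v : Eu d → ℝ}
    (hv : v ∈ discreteV0 Ω K) : ∀ x ∉ Ω, v x = 0 := by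
  obtain ⟨p, -, rfl⟩ := hv
  exact fun x hx => indicator_of_notMem hx _

lemma eq_zero_of_mem_discreteVc {K : Geometry.SimplicialComplex ℝ (Eu d)} {v : Eu d → ℝ}
    (hv : v ∈ discreteVc Ω δ K) : ∀ x ∈ Ω, v x = 0 := by
  obtain ⟨p, -, rfl⟩ := hv
  exact fun x hx => indicator_of_notMem (fun h => h.1 hx) _

/-- Galerkin identity for the CDG approximation. -/
lemma cdg_weak_form (hΩ : IsOpen Ω) (hb : Bornology.IsBounded Ω) (hk : IsRadialKernel δ k)
    (hγ : ∀ x y, γ x y = k (y - x)) {u₀ gh w : Eu d → ℝ}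
    (hu₀ : MemLp u₀ 2 (volume.restrict (extendedDomain Ω δ))) (hu₀0 : ∀ x ∉ Ω, u₀ x = 0)
    (hgh : MemLp gh 2 (volume.restrict (extendedDomain Ω δ))) (hgh0 : ∀ x ∈ Ω, gh x = 0)
    (hw : MemLp w 2 (volume.restrict (extendedDomain Ω δ))) (hw0 : ∀ x ∉ Ω, w x = 0)
    (heq : -2 * ∫ x in Ω, w x * ∫ y in Metric.ball x δ ∩ Ω, (u₀ y - u₀ x) * γ x y
        = (∫ x in Ω, f x * w x)
          + 2 * ∫ x in Ω, w x * ∫ y in Metric.ball x δ ∩ interactionDomain Ω δ,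
              (gh y - u₀ x) * γ x y) :
    inner ℝ (incrementLp hk.integrable hk.even (hu₀.add hgh))
      (incrementLp hk.integrable hk.even hw) = ∫ x in Ω, f x * w x := by
  set E := extendedDomain Ω δ
  set v : Eu d → ℝ := u₀ + gh with hv
  have hvL : MemLp v 2 (volume.restrict E) := hu₀.add hgh
  have hE : MeasurableSet E := (isOpen_extendedDomain hΩ δ).measurableSet
  have hc := measurableSet_interactionDomain hΩ δ
  have hfin : IsFiniteMeasure (volume.restrict E) :=
    ⟨by simpa using (isBounded_extendedDomain hb δ).measure_lt_top⟩
  -- The kernel vanishes off the ball, so the balls in the scheme may be dropped. What remains are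
  -- the integrals over Ω and over the interaction domain of the single function v = u₀ + gh.
  have hball : ∀ (x : Eu d) (S : Set (Eu d)), MeasurableSet S → ∀ F : Eu d → ℝ,
      ∫ y in Metric.ball x δ ∩ S, F y * k (y - x) = ∫ y in S, F y * k (y - x) := fun x S hS F =>
    (setIntegral_eq_of_subset_of_forall_sdiff_eq_zero hS inter_subset_right fun y hy => by
      rw [hk.eq_zero_of_notMem_ball fun h => hy.2 ⟨h, hy.1⟩, mul_zero]).symm
  have hA : ∀ x ∈ Ω, ∫ y in Metric.ball x δ ∩ Ω, (u₀ y - u₀ x) * γ x y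
      = ∫ y in Ω, (v y - v x) * k (y - x) := by
    intro x hx
    simp_rw [hγ]
    rw [hball x Ω hΩ.measurableSet fun y => u₀ y - u₀ x]
    refine setIntegral_congr_fun hΩ.measurableSet fun y hy => ?_
    simp [hv, hgh0 x hx, hgh0 y hy]
  have hB : ∀ x ∈ Ω, ∫ y in Metric.ball x δ ∩ interactionDomain Ω δ, (gh y - u₀ x) * γ x y
      = ∫ y in interactionDomain Ω δ, (v y - v x) * k (y - x) := by
    intro x hx
    simp_rw [hγ]
    rw [hball x _ hc fun y => gh y - u₀ x]
    refine setIntegral_congr_fun hc fun y hy => ?_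
    simp [hv, hgh0 x hx, hu₀0 y hy.1]
  rw [setIntegral_congr_fun hΩ.measurableSet fun x hx => by
      simpa only using congrArg (w x * ·) (hA x hx),
    setIntegral_congr_fun hΩ.measurableSet (f := fun x => w x *
      ∫ y in Metric.ball x δ ∩ interactionDomain Ω δ, (gh y - u₀ x) * γ x y) fun x hx => by
      simpa only using congrArg (w x * ·) (hB x hx)] at heq
  have hI : ∀ S : Set (Eu d), MeasurableSet S → S ⊆ E →
      IntegrableOn (fun x => w x * ∫ y in S, (v y - v x) * k (y - x)) Ω := by
    intro S hS hSE
    have h1 := integrable_integral_pairMeasure hk.aemeasurable hk.nonneg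
      (integrable_mul_increment hk.integrable hk.even hvL hw) hS hSE
    refine IntegrableOn.mono_set (h1.congr (Eventually.of_forall fun x => ?_))
      subset_extendedDomain
    simp only
    rw [← integral_const_mul]
    refine integral_congr_ae (Eventually.of_forall fun y => ?_)
    simp only [increment]; ring
  -- With the constant 1 as test function, Fubini gives integrability of the inner integrand for
  -- almost every x, which is needed to split E into Ω and the interaction domain.
  have hone : MemLp (fun _ : Eu d => (1 : ℝ)) 2 (volume.restrict E) := memLp_const 1
  have hae := ae_integrable_pairMeasure hk.aemeasurable hk.nonneg
    (integrable_mul_increment hk.integrable hk.even hvL hone)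
  have hsplit : ∫ x in Ω, w x * ∫ y in E, (v y - v x) * k (y - x)
      = (∫ x in Ω, w x * ∫ y in Ω, (v y - v x) * k (y - x))
        + ∫ x in Ω, w x * ∫ y in interactionDomain Ω δ, (v y - v x) * k (y - x) := by
    rw [← integral_add (hI Ω hΩ.measurableSet subset_extendedDomain)
      (hI _ hc interactionDomain_subset)]
    refine integral_congr_ae ?_
    filter_upwards [ae_mono (Measure.restrict_mono subset_extendedDomain le_rfl) hae] with x hx
    have hx' : IntegrableOn (fun y => (v y - v x) * k (y - x)) E :=
      hx.congr (Eventually.of_forall fun y => by simp only [increment]; ring)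
    rw [← mul_add, ← setIntegral_union disjoint_interactionDomain hc
      (hx'.mono_set subset_extendedDomain) (hx'.mono_set interactionDomain_subset)]
    rfl
  have hgreen := nonlocal_green hk.integrable hk.nonneg hk.even hE
    (Ω := Ω) subset_extendedDomain hvL hw hw0
  rw [← hgreen, hsplit, mul_add, heq]
  ring

end WeakForms

end NonlocalCDG

/-! ### Stability and quasi-optimality -/

namespace NonlocalCDG

variable {d : ℕ} {Ω : Set (Eu d)} {δ : ℝ} {k : Eu d → ℝ}

lemma norm_le_of_sq_le_mul {a b : ℝ} (ha : 0 ≤ a) (hb : 0 ≤ b) (h : a ^ 2 ≤ b * a) : a ≤ b := by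
  rcases ha.eq_or_lt with h0 | h0
  · rw [← h0]; exact hb
  · exact le_of_mul_le_mul_right (by linarith [pow_two a]) h0

/-- Pythagoras: e - q = a - w with a orthogonal to w, so each leg is at most the hypotenuse. -/
lemma norm_le_of_inner_eq_zero {H : Type*} [NormedAddCommGroup H] [InnerProductSpace ℝ H]
    {a e q w : H} (ha : a = e - q + w) (h : inner ℝ a w = 0) :
    ‖a‖ ≤ ‖e‖ + ‖q‖ ∧ ‖w‖ ≤ ‖e‖ + ‖q‖ := by
  have h1 : ‖e - q‖ ^ 2 = ‖a‖ ^ 2 + ‖w‖ ^ 2 := by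
    have : e - q = a - w := by rw [ha]; abel
    rw [this, norm_sub_sq_real, h]; ring
  have h2 := norm_sub_le e q
  constructor
  · exact (abs_le_of_sq_le_sq' (by nlinarith [sq_nonneg ‖w‖]) (norm_nonneg _)).2.trans h2
  · exact (abs_le_of_sq_le_sq' (by nlinarith [sq_nonneg ‖a‖]) (norm_nonneg _)).2.trans h2

/-- Stability of the nonlocal problem: an estimate of the error in terms of the residual in `Ω` and
of the error `u - v` in the interaction domain. -/
lemma SolvesNonlocal.norm_sub_le {γ : Eu d → Eu d → ℝ} {f g u v : Eu d → ℝ}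
    (hu : SolvesNonlocal Ω δ γ f g u) (hd : 1 ≤ d) (hδ : 0 < δ) (hΩ : IsOpen Ω)
    (hb : Bornology.IsBounded Ω) (hk : IsRadialKernel δ k) (hγ : ∀ x y, γ x y = k (y - x))
    (hf : AEStronglyMeasurable f (volume.restrict Ω))
    (hv : MemLp v 2 (volume.restrict (extendedDomain Ω δ))) {A V D : ℝ} (hA : 0 ≤ A)
    (hres : ∀ x ∈ Ω,
      |f x + 2 * (∫ y in extendedDomain Ω δ, (v y - v x) * k (y - x))| ≤ A)
    (hV : volume (extendedDomain Ω δ) ≤ ENNReal.ofReal V)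
    (hD0 : 0 ≤ D) (hD : ∀ x ∈ Ω, ∀ y ∈ Ω, ‖y - x‖ ≤ D)
    (he : MemLp (Ω.indicator (u - v)) 2 (volume.restrict (extendedDomain Ω δ)))
    (hr : MemLp ((interactionDomain Ω δ).indicator (u - v)) 2
      (volume.restrict (extendedDomain Ω δ))) :
    ‖incrementLp hk.integrable hk.even he‖
      ≤ √V * A * (D + δ) + ‖incrementLp hk.integrable hk.even hr‖ := by
  set E := extendedDomain Ω δ with hEdef
  have hE : MeasurableSet E := (isOpen_extendedDomain hΩ δ).measurableSet
  set e := Ω.indicator (u - v) with hedef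
  set r := (interactionDomain Ω δ).indicator (u - v) with hrdef
  have he0 : ∀ x ∉ Ω, e x = 0 := fun x hx => indicator_of_notMem hx _
  have hfin : IsFiniteMeasure (volume.restrict E) :=
    ⟨by simpa using (isBounded_extendedDomain hb δ).measure_lt_top⟩
  have hfinΩ : IsFiniteMeasure (volume.restrict Ω) := ⟨by simpa using hb.measure_lt_top⟩
  have hdecomp : incrementLp hk.integrable hk.even hu.1.memLp
      = incrementLp hk.integrable hk.even hv + incrementLp hk.integrable hk.even he
        + incrementLp hk.integrable hk.even hr := by
    rw [← incrementLp_add, ← incrementLp_add]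
    refine incrementLp_congr _ _ _ _ ((ae_restrict_iff' hE).2 (Eventually.of_forall ?_))
    rintro x (hx | hx)
    · have : x ∉ interactionDomain Ω δ := fun h => h.1 hx
      simp [hedef, hrdef, hx, this]
    · simp [hedef, hrdef, hx, hx.1]
  set L : Eu d → ℝ := fun x => ∫ y in E, (v y - v x) * k (y - x) with hL
  have hmeas : ∀ w : Eu d → ℝ, MemLp w 2 (volume.restrict E) →
      IntegrableOn (fun x => w x * L x) Ω := by
    intro w hw
    have h1 := integrable_integral_pairMeasure hk.aemeasurable hk.nonneg
      (integrable_mul_increment hk.integrable hk.even hv hw) hE subset_rfl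
    refine IntegrableOn.mono_set (h1.congr (Eventually.of_forall fun x => ?_))
      subset_extendedDomain
    simp only [hL]
    rw [← integral_const_mul]
    refine integral_congr_ae (Eventually.of_forall fun y => ?_)
    simp only [increment]; ring
  -- Testing with the constant 1 shows that the operator applied to v is measurable, so the bounded
  -- residual lies in L².
  have hLI : IntegrableOn L Ω :=
    (hmeas (fun _ => 1) (memLp_const 1)).congr (Eventually.of_forall fun x => by simp)
  have hFm : AEStronglyMeasurable (fun x => f x + 2 * L x) (volume.restrict Ω) :=
    hf.add (hLI.aestronglyMeasurable.const_mul 2)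
  have hFb : ∀ᵐ x ∂(volume.restrict Ω), |f x + 2 * L x| ≤ A :=
    (ae_restrict_iff' hΩ.measurableSet).2 (Eventually.of_forall hres)
  have hF : MemLp (fun x => f x + 2 * L x) 2 (volume.restrict Ω) := MemLp.of_bound hFm A hFb
  have heΩ : MemLp e 2 (volume.restrict Ω) :=
    he.mono_measure (Measure.restrict_mono subset_extendedDomain le_rfl)
  have hFe : IntegrableOn (fun x => (f x + 2 * L x) * e x) Ω := hF.integrable_mul heΩ
  have hgreen := nonlocal_green hk.integrable hk.nonneg hk.even hE
    (Ω := Ω) subset_extendedDomain hv he he0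
  have hweak := hu.weak_form hΩ hk hγ he he0
  have hdiff : (∫ x in Ω, f x * e x) - inner ℝ (incrementLp hk.integrable hk.even hv)
      (incrementLp hk.integrable hk.even he) = ∫ x in Ω, (f x + 2 * L x) * e x := by
    have h1 := integral_sub hFe ((hmeas e he).const_mul 2)
    rw [integral_const_mul] at h1
    have h2 : ∫ x in Ω, f x * e x
        = ∫ x in Ω, ((f x + 2 * L x) * e x - 2 * (e x * L x)) :=
      integral_congr_ae (Eventually.of_forall fun x => by simp only; ring)
    rw [h2, h1, ← hgreen]
    ring
  have hVΩ : (volume.restrict Ω) univ ≤ ENNReal.ofReal V := by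
    rw [Measure.restrict_apply_univ]
    exact (measure_mono subset_extendedDomain).trans hV
  have hFn : (eLpNorm (fun x => f x + 2 * L x) 2 (volume.restrict Ω)).toReal ≤ √V * A :=
    ENNReal.toReal_le_of_le_ofReal (by positivity) (eLpNorm_two_le_of_ae_bound hVΩ hFb)
  have hen : (eLpNorm e 2 (volume.restrict Ω)).toReal
      ≤ (D + δ) * ‖incrementLp hk.integrable hk.even he‖ :=
    ENNReal.toReal_le_of_le_ofReal (by positivity)
      ((eLpNorm_mono_measure e Measure.restrict_le_self).trans
        (hk.poincare hd hΩ hD0 hD hδ he he0))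
  have hcs := abs_integral_mul_le hF heΩ
  refine norm_le_of_sq_le_mul (norm_nonneg _) (by positivity) ?_
  -- Testing with e itself: u = v + e + r, and the weak form of u removes u. The residual is paired
  -- with e in L² and returned to energy by Poincaré; the term with r needs only Cauchy–Schwarz in
  -- energy.
  have hin : ‖incrementLp hk.integrable hk.even he‖ ^ 2
      = (∫ x in Ω, (f x + 2 * L x) * e x) - inner ℝ (incrementLp hk.integrable hk.even hr)
        (incrementLp hk.integrable hk.even he) := by
    rw [← hdiff, ← hweak, hdecomp, inner_add_left, inner_add_left, real_inner_self_eq_norm_sq]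
    ring
  have h3 := abs_le.1 (abs_real_inner_le_norm (incrementLp hk.integrable hk.even hr)
    (incrementLp hk.integrable hk.even he))
  have h4 := (le_abs_self _).trans hcs
  have h5 := mul_le_mul hFn hen ENNReal.toReal_nonneg (by positivity)
  rw [hin]
  nlinarith [h3.1]

/-- Quasi-optimality of the CDG approximation: if a discrete function with the boundary values `gh`
is given by `I` in `Ω`, the error is controlled by the continuous error `u - v` in `Ω` and by `B`. -/
lemma cdg_error_le {γ : Eu d → Eu d → ℝ} {f g u v : Eu d → ℝ}
    (hu : SolvesNonlocal Ω δ γ f g u) (hd : 1 ≤ d) (hδ : 0 < δ) (hΩ : IsOpen Ω)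
    (hb : Bornology.IsBounded Ω) (hk : IsRadialKernel δ k) (hγ : ∀ x y, γ x y = k (y - x))
    (hv : MemLp v 2 (volume.restrict (extendedDomain Ω δ))) {B G V D h : ℝ} (hB : 0 ≤ B)
    (hG : ∫⁻ z, ENNReal.ofReal (k z) ≤ ENNReal.ofReal G)
    (hV : volume (extendedDomain Ω δ) ≤ ENNReal.ofReal V)
    (hD0 : 0 ≤ D) (hD : ∀ x ∈ Ω, ∀ y ∈ Ω, ‖y - x‖ ≤ D)
    (he : MemLp (Ω.indicator (u - v)) 2 (volume.restrict (extendedDomain Ω δ)))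
    {K Kc : Geometry.SimplicialComplex ℝ (Eu d)} (hK : IsMeshOfDomain Ω K h)
    (hKc : IsMeshOfInteraction Ω δ Kc h) {gh uh p : Eu d → ℝ} (hgh : gh ∈ discreteVc Ω δ Kc)
    (hp : IsPiecewiseLinear K p) (hpB : ∀ x ∈ Ω, |p x - v x| ≤ B)
    (hgB : ∀ x ∈ interactionDomain Ω δ, |g x - gh x| ≤ B)
    (huh : IsCDGSolution Ω δ γ K f gh uh) {N : ℝ}
    (hN : ‖incrementLp hk.integrable hk.even he‖ ≤ N) :
    energyNorm Ω δ γ (fun x => u x - uh x) ≤ ENNReal.ofReal (N + 2 * √G * (√V * B)) ∧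
    eLpNorm (fun x => u x - uh x) 2 (volume.restrict Ω)
      ≤ ENNReal.ofReal ((D + δ) * (2 * N + 2 * √G * (√V * B)) + √V * B) := by
  obtain ⟨u₀, hu₀, heq, rfl⟩ := huh
  set E := extendedDomain Ω δ with hEdef
  have hE : MeasurableSet E := (isOpen_extendedDomain hΩ δ).measurableSet
  have hc := measurableSet_interactionDomain hΩ δ
  set w : Eu d → ℝ := Ω.indicator p - u₀ with hw
  have hIV : Ω.indicator p ∈ discreteV0 Ω K := ⟨p, hp, rfl⟩
  have hwV : w ∈ discreteV0 Ω K := by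
    obtain ⟨p₀, hp₀, rfl⟩ := hu₀
    refine ⟨p - p₀, ⟨hp.continuousOn.sub hp₀.continuousOn, fun s hs => ?_⟩, ?_⟩
    · obtain ⟨A, hA⟩ := hp.affine s hs
      obtain ⟨A₀, hA₀⟩ := hp₀.affine s hs
      exact ⟨A - A₀, fun x hx => by simp [hA hx, hA₀ hx]⟩
    · rw [hw, indicator_sub']
  have hIL := memLp_of_mem_discreteV0 hΩ hb hK hIV δ
  have hu₀L := memLp_of_mem_discreteV0 hΩ hb hK hu₀ δ
  have hwL : MemLp w 2 (volume.restrict E) := hIL.sub hu₀L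
  have hw0 := eq_zero_of_mem_discreteV0 hwV
  have hu₀0 := eq_zero_of_mem_discreteV0 hu₀
  have hghL := memLp_of_mem_discreteVc hΩ hb hKc hgh
  have hgh0 := eq_zero_of_mem_discreteVc hgh
  have huhL : MemLp (u₀ + gh) 2 (volume.restrict E) := hu₀L.add hghL
  set e := Ω.indicator (u - v) with hedef
  have he0 : ∀ x ∉ Ω, e x = 0 := fun x hx => indicator_of_notMem hx _
  -- Everything of size h²: the interpolation error in Ω and the error of the discrete constraint
  -- outside. The function w above vanishes off Ω and is discrete, hence admissible in both weak
  -- forms.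
  set q : Eu d → ℝ := Ω.indicator (Ω.indicator p - v)
    + (interactionDomain Ω δ).indicator (gh - u) with hq
  have hqL : MemLp q 2 (volume.restrict E) :=
    ((hIL.sub hv).indicator hΩ.measurableSet).add ((hghL.sub hu.1.memLp).indicator hc)
  have hug : ∀ᵐ x ∂(volume.restrict E), x ∈ interactionDomain Ω δ → u x = g x :=
    ae_restrict_of_ae ((ae_restrict_iff' hc).1 hu.1.constraint)
  have hqB : ∀ᵐ x ∂(volume.restrict E), |q x| ≤ B := by
    filter_upwards [hug, ae_restrict_mem hE] with x hx hxE
    rcases hxE with h | h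
    · have : x ∉ interactionDomain Ω δ := fun h' => h'.1 h
      simpa [hq, h, this] using hpB x h
    · have := hgB x h
      rw [abs_sub_comm, ← hx h] at this
      simpa [hq, h, h.1] using this
  have hdecomp : ∀ x ∈ E, u x - (u₀ x + gh x) = e x - q x + w x := by
    rintro x (h | h)
    · have : x ∉ interactionDomain Ω δ := fun h' => h'.1 h
      simp [hq, hedef, hw, h, this, hgh0 x h]
    · simp [hq, hedef, hw, h, h.1, hu₀0 x h.1]
  have hT : incrementLp hk.integrable hk.even (hu.1.memLp.sub huhL)
      = incrementLp hk.integrable hk.even he - incrementLp hk.integrable hk.even hqL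
        + incrementLp hk.integrable hk.even hwL := by
    rw [← incrementLp_sub, ← incrementLp_add]
    exact incrementLp_congr _ _ _ _ ((ae_restrict_iff' hE).2 (Eventually.of_forall hdecomp))
  have horth : inner ℝ (incrementLp hk.integrable hk.even (hu.1.memLp.sub huhL))
      (incrementLp hk.integrable hk.even hwL) = 0 := by
    rw [incrementLp_sub hk.integrable hk.even hu.1.memLp huhL, inner_sub_left, hu.weak_form hΩ hk hγ hwL hw0,
      cdg_weak_form hΩ hb hk hγ hu₀L hu₀0 hghL hgh0 hwL hw0 (heq w hwV), sub_self]
  obtain ⟨h1, h2⟩ := norm_le_of_inner_eq_zero hT horth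
  have hVE : (volume.restrict E) univ ≤ ENNReal.ofReal V := by
    rwa [Measure.restrict_apply_univ]
  have hqn := eLpNorm_two_le_of_ae_bound hVE hqB
  have hTq := norm_incrementLp_le hk.integrable hk.even (by positivity) hG hqL hqn
  have hN0 : 0 ≤ N := (norm_nonneg _).trans hN
  constructor
  · have hmeas : AEStronglyMeasurable (fun x => u x - (u₀ x + gh x)) (volume.restrict E) :=
      (hu.1.memLp.sub huhL).aestronglyMeasurable
    rw [energyNorm_eq hγ hk.aemeasurable hmeas]
    refine (ENNReal.le_ofReal_iff_toReal_le ?_ (by positivity)).2 ?_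
    · exact (memLp_increment hk.integrable hk.even (hu.1.memLp.sub huhL)).eLpNorm_lt_top.ne
    · rw [norm_incrementLp] at h1
      exact h1.trans (add_le_add hN hTq)
  · have hmono : volume.restrict Ω ≤ volume.restrict E :=
      Measure.restrict_mono subset_extendedDomain le_rfl
    have hcongr : eLpNorm (fun x => u x - (u₀ x + gh x)) 2 (volume.restrict Ω)
        = eLpNorm (e - q + w) 2 (volume.restrict Ω) := by
      refine eLpNorm_congr_ae ((ae_restrict_iff' hΩ.measurableSet).2 (Eventually.of_forall ?_))
      exact fun x hx => hdecomp x (subset_extendedDomain hx)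
    have hem := (he.mono_measure hmono).aestronglyMeasurable
    have hqm := (hqL.mono_measure hmono).aestronglyMeasurable
    have hwm := (hwL.mono_measure hmono).aestronglyMeasurable
    -- The full error does not vanish on the interaction domain, so Poincaré is applied to e and w
    -- separately, while q is bounded directly.
    have hpe := (eLpNorm_mono_measure e (Measure.restrict_le_self (s := Ω))).trans
        (hk.poincare hd hΩ hD0 hD hδ he he0)
    have hpw := (eLpNorm_mono_measure w (Measure.restrict_le_self (s := Ω))).trans
        (hk.poincare hd hΩ hD0 hD hδ hwL hw0)
    have hpq := (eLpNorm_mono_measure q hmono).trans hqn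
    rw [hcongr]
    refine (eLpNorm_add_le (hem.sub hqm) hwm (by norm_num)).trans ?_
    refine (add_le_add_left (eLpNorm_sub_le hem hqm (by norm_num)) _).trans ?_
    refine (add_le_add (add_le_add hpe hpq) hpw).trans ?_
    rw [← ENNReal.ofReal_add (by positivity) (by positivity),
      ← ENNReal.ofReal_add (by positivity) (by positivity)]
    refine ENNReal.ofReal_le_ofReal ?_
    have h3 := h2.trans (add_le_add hN hTq)
    have hDδ : 0 ≤ D + δ := by positivity
    nlinarith

end NonlocalCDG

/-! ### Rates in δ and assembly of the constants -/

namespace NonlocalCDG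

/-- The surplus exponents over (3 + μ)/2 are (1 - μ)/2 and μ/2. Both lie in [0, 1], so the surplus
powers of δ are at most 1 + δ₀. -/
lemma rpow_rate_bounds {δ δ₀ : ℝ} (hδ : 0 < δ) (hδ₀ : δ ≤ δ₀) {μ : ℕ} (hμ : μ = 0 ∨ μ = 1) :
    δ ^ 2 ≤ (1 + δ₀) * δ ^ ((3 + (μ : ℝ)) / 2) ∧
    √δ * (δ⁻¹ * δ ^ (2 + μ)) ≤ (1 + δ₀) * δ ^ ((3 + (μ : ℝ)) / 2) := by
  have hpow : ∀ a : ℝ, 0 ≤ a → a ≤ 1 → δ ^ a ≤ 1 + δ₀ := fun a h0 h1 =>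
    calc δ ^ a ≤ (1 + δ₀) ^ a := Real.rpow_le_rpow hδ.le (by linarith) h0
      _ ≤ (1 + δ₀) ^ (1 : ℝ) := Real.rpow_le_rpow_of_exponent_le (by linarith) h1
      _ = 1 + δ₀ := Real.rpow_one _
  have hη : 0 ≤ δ ^ ((3 + (μ : ℝ)) / 2) := Real.rpow_nonneg hδ.le _
  constructor
  · calc δ ^ 2 = δ ^ ((1 - (μ : ℝ)) / 2) * δ ^ ((3 + (μ : ℝ)) / 2) := by
          rw [← Real.rpow_add hδ, ← Real.rpow_natCast]; congr 1; push_cast; ring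
      _ ≤ _ := by
          gcongr
          refine hpow _ ?_ ?_ <;> rcases hμ with rfl | rfl <;> norm_num
  · calc √δ * (δ⁻¹ * δ ^ (2 + μ)) = δ ^ ((μ : ℝ) / 2) * δ ^ ((3 + (μ : ℝ)) / 2) := by
          rw [Real.sqrt_eq_rpow, ← Real.rpow_neg_one, ← Real.rpow_natCast, ← Real.rpow_add hδ,
            ← Real.rpow_add hδ, ← Real.rpow_add hδ]
          congr 1; push_cast; ring
      _ ≤ _ := by
          gcongr
          refine hpow _ ?_ ?_ <;> rcases hμ with rfl | rfl <;> norm_num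

lemma IsCb.exists_bound {d n : ℕ} {D : Set (Eu d)} {u : Eu d → ℝ} (hu : IsCb n D u) {j : ℕ}
    (hj : j ≤ n) : ∃ M : ℝ, 0 ≤ M ∧ ∀ x ∈ D, ‖iteratedFDerivWithin ℝ j u D x‖ ≤ M := by
  obtain ⟨M, hM⟩ := hu.2 j hj
  exact ⟨|M|, abs_nonneg M, fun x hx => (hM x hx).trans (le_abs_self M)⟩

/-- At a point of Ω the whole ball lies in the extended domain, so the full mass of k already occurs
in the supremum. -/
lemma IsRadialKernel.lintegral_le {d : ℕ} {Ω : Set (Eu d)} {δ : ℝ} {γ : Eu d → Eu d → ℝ}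
    {k : Eu d → ℝ} (hk : IsRadialKernel δ k) (hγ : ∀ x y, γ x y = k (y - x))
    (hΩ : Ω.Nonempty) : ∫⁻ z, ENNReal.ofReal (k z) ≤ kernelMass Ω δ γ := by
  obtain ⟨x, hx⟩ := hΩ
  have hball : Metric.ball x δ ∩ extendedDomain Ω δ = Metric.ball x δ :=
    inter_eq_left.2 (ball_subset_extendedDomain hx)
  refine le_trans (le_of_eq ?_) (le_iSup₂ (f := fun x (_ : x ∈ extendedDomain Ω δ) =>
    ∫⁻ y in Metric.ball x δ ∩ extendedDomain Ω δ, ENNReal.ofReal (γ x y)) x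
    (subset_extendedDomain hx))
  simp only [hball, hγ]
  rw [← lintegral_sub_right_eq_self (fun z => ENNReal.ofReal (k z)) x,
    ← lintegral_indicator Metric.isOpen_ball.measurableSet]
  refine lintegral_congr fun y => ?_
  by_cases hy : y ∈ Metric.ball x δ
  · rw [indicator_of_mem hy]
  · rw [indicator_of_notMem hy, hk.eq_zero_of_notMem_ball hy]; simp

lemma extendedDomain_empty {d : ℕ} (δ : ℝ) : extendedDomain (∅ : Set (Eu d)) δ = ∅ := by
  rw [extendedDomain_eq, frontier_empty, Metric.thickening_empty, union_empty]

lemma energy_rate_le {a b c η θ : ℝ} (ha : 0 ≤ a) (hb : 0 ≤ b) (hc : 0 ≤ c) (hη : 0 ≤ η)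
    (hθ : 0 ≤ θ) : a * η + b * θ ≤ (1 + a + b + c) * (η + θ) := by
  nlinarith [mul_nonneg ha hθ, mul_nonneg hb hη, mul_nonneg hc (add_nonneg hη hθ)]

lemma l2_rate_le {a b B V D δ δ₀ η θ q : ℝ} (ha : 0 ≤ a) (hb : 0 ≤ b) (hB : 0 ≤ B)
    (hδ₀ : 0 ≤ δ₀) (hδ : δ ≤ δ₀) (hD : 0 ≤ D + δ) (hη : 0 ≤ η) (hθ : 0 ≤ θ) (hq : q ≤ δ₀ * θ) :
    (D + δ) * (2 * (a * η) + b * θ) + √V * (B * q)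
      ≤ (1 + a + b + ((D + δ₀) * (2 * a + b) + √V * B * δ₀)) * (η + θ) := by
  have h1 : (D + δ) * (2 * (a * η) + b * θ) ≤ (D + δ₀) * ((2 * a + b) * (η + θ)) := by
    have : 2 * (a * η) + b * θ ≤ (2 * a + b) * (η + θ) := by
      nlinarith [mul_nonneg ha hθ, mul_nonneg hb hη]
    exact mul_le_mul (by linarith) this (by positivity) (by linarith)
  have hq' : √V * (B * q) ≤ √V * B * (δ₀ * θ) := by
    rw [mul_assoc]; gcongr
  have h2 : √V * B * (δ₀ * θ) ≤ √V * B * δ₀ * (η + θ) := by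
    rw [mul_assoc _ δ₀]
    gcongr
    linarith
  nlinarith [mul_nonneg ha (add_nonneg hη hθ), mul_nonneg hb (add_nonneg hη hθ)]

end NonlocalCDG

/-! ### The main theorem -/

open NonlocalCDG

theorem mainTheorem6 {d : ℕ} (hd : 1 ≤ d)
    (Ω : Set (NonlocalCDG.Eu d)) (hΩ : NonlocalCDG.IsBoundedOpenPolyhedron Ω)
    -- the local solution and its extension
    (f₀ g₀ u₀ : NonlocalCDG.Eu d → ℝ) (hu₀ : NonlocalCDG.SolvesLocalProblem Ω f₀ g₀ u₀)
    (δ₀ : ℝ) (hδ₀ : 0 < δ₀)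
    (ut : NonlocalCDG.Eu d → ℝ)
    (hut : NonlocalCDG.IsCb 4 (NonlocalCDG.extendedDomain Ω δ₀) ut)
    (hut_ext : ∀ x ∈ Ω, ut x = u₀ x)
    -- the families of kernels, right-hand sides and volume constraints
    (γ : ℝ → NonlocalCDG.Eu d → NonlocalCDG.Eu d → ℝ)
    (hγ : ∀ δ ∈ Set.Ioc 0 δ₀, NonlocalCDG.IsKernel Ω δ (γ δ))
    (CG : ℝ)
    (hG : ∀ δ ∈ Set.Ioc 0 δ₀,
      NonlocalCDG.kernelMass Ω δ (γ δ) ≤ ENNReal.ofReal (CG * δ ^ (-2 : ℤ)))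
    (f g : ℝ → NonlocalCDG.Eu d → ℝ)
    (hf_meas : ∀ δ ∈ Set.Ioc 0 δ₀,
      MeasureTheory.AEStronglyMeasurable (f δ) (MeasureTheory.volume.restrict Ω))
    (μ : ℕ) (hμ : μ = 0 ∨ μ = 1)
    (Cf Cg : ℝ)
    (hf : ∀ δ ∈ Set.Ioc 0 δ₀, ∀ x ∈ Ω, |f δ x - f₀ x| ≤ Cf * δ ^ 2)
    (hg : ∀ δ ∈ Set.Ioc 0 δ₀, ∀ x ∈ NonlocalCDG.interactionDomain Ω δ,
      |g δ x - ut x| ≤ Cg * δ ^ (2 + μ))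
    -- the accuracy constant of the discretized volume constraints
    (Ch : ℝ) :
    ∃ C : ℝ, 0 < C ∧ ∀ δ ∈ Set.Ioc 0 δ₀, ∀ h : ℝ, 0 < h →
      ∀ K Kc : Geometry.SimplicialComplex ℝ (NonlocalCDG.Eu d),
      NonlocalCDG.IsMeshOfDomain Ω K h → NonlocalCDG.IsMeshOfInteraction Ω δ Kc h →
      ∀ gh ∈ NonlocalCDG.discreteVc Ω δ Kc,
      (∀ x ∈ NonlocalCDG.interactionDomain Ω δ, |g δ x - gh x| ≤ Ch * h ^ 2) →
      ∀ u uh : NonlocalCDG.Eu d → ℝ,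
      NonlocalCDG.SolvesNonlocal Ω δ (γ δ) (f δ) (g δ) u →
      NonlocalCDG.IsCDGSolution Ω δ (γ δ) K (f δ) gh uh →
      NonlocalCDG.energyNorm Ω δ (γ δ) (fun x => u x - uh x)
          ≤ ENNReal.ofReal (C * (δ ^ ((3 + (μ : ℝ)) / 2) + δ⁻¹ * h ^ 2)) ∧
      MeasureTheory.eLpNorm (fun x => u x - uh x) 2 (MeasureTheory.volume.restrict Ω)
          ≤ ENNReal.ofReal (C * (δ ^ ((3 + (μ : ℝ)) / 2) + δ⁻¹ * h ^ 2)) := by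
  have hΩo := hΩ.1
  have hb := hΩ.2.1
  -- A point of Ω is needed to extract the radial kernel; for empty Ω both norms are zero.
  rcases Ω.eq_empty_or_nonempty with rfl | hne
  · refine ⟨1, one_pos, fun δ _ h _ K Kc _ _ gh _ _ u uh _ _ => ⟨?_, ?_⟩⟩
    · rw [energyNorm, extendedDomain_empty]; simp
    · simp
  obtain ⟨M₀, -, hM₀'⟩ := hut.exists_bound (j := 0) (by norm_num)
  obtain ⟨M₂, hM₂0, hM₂⟩ := hut.exists_bound (j := 2) (by norm_num)
  obtain ⟨M₄, hM₄0, hM₄⟩ := hut.exists_bound (j := 4) (by norm_num)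
  have hM₀ : ∀ x ∈ extendedDomain Ω δ₀, |ut x| ≤ M₀ := fun x hx => by
    simpa [norm_iteratedFDerivWithin_zero] using hM₀' x hx
  obtain ⟨C₁, hC₁0, hC₁⟩ := hΩ.exists_volume_interactionDomain_le δ₀
  obtain ⟨D, hD⟩ := hb.exists_norm_le
  have hD0 : 0 ≤ D + D := by
    obtain ⟨x, hx⟩ := hne
    have := (norm_nonneg x).trans (hD x hx)
    linarith
  have hDΩ : ∀ x ∈ Ω, ∀ y ∈ Ω, ‖y - x‖ ≤ D + D := fun x hx y hy =>
    (norm_sub_le y x).trans (add_le_add (hD y hy) (hD x hx))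
  have hopen := isOpen_extendedDomain hΩo δ₀
  have hfinE : volume (extendedDomain Ω δ₀) ≠ ∞ :=
    (isBounded_extendedDomain hb δ₀).measure_lt_top.ne
  set V := (volume (extendedDomain Ω δ₀)).toReal with hVdef
  -- A bounds the residual over δ², B the pointwise errors over h²; K₁ and K₂ are the resulting
  -- energy constants of the δ-part and the h-part. Absolute values appear because no sign is
  -- assumed on the given constants.
  set A := |Cf| + 2 * M₄ * d with hA
  set B := M₂ + |Ch| with hB
  set K₁ := (√V * A * (D + D + δ₀) + 2 * √|CG| * (√C₁ * |Cg|)) * (1 + δ₀) with hK₁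
  set K₂ := 2 * √|CG| * (√V * B) with hK₂
  have hA0 : 0 ≤ A := by positivity
  have hB0 : 0 ≤ B := by positivity
  have hDδ₀ : 0 ≤ D + D + δ₀ := by positivity
  have hK₁0 : 0 ≤ K₁ := by positivity
  have hK₂0 : 0 ≤ K₂ := by positivity
  -- One constant for both estimates: K₁ and K₂ serve the energy norm, the last bracket adds the
  -- Poincaré factor and the L² norm of q, and 1 ensures positivity.
  refine ⟨1 + K₁ + K₂ + ((D + D + δ₀) * (2 * K₁ + K₂) + √V * B * δ₀), by positivity, ?_⟩
  intro δ hδ h hh K Kc hK hKc gh hgh hggh u uh hu huh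
  obtain ⟨k, hk, hγk⟩ := (hγ δ hδ).exists_isRadialKernel hd hδ.1 hne
  set E := extendedDomain Ω δ with hE
  have hEm : MeasurableSet E := (isOpen_extendedDomain hΩo δ).measurableSet
  have hc := measurableSet_interactionDomain hΩo δ
  have hEsub : E ⊆ extendedDomain Ω δ₀ := extendedDomain_mono Ω hδ.2
  have hV : volume E ≤ ENNReal.ofReal V := by
    rw [hVdef, ENNReal.ofReal_toReal hfinE]
    exact measure_mono hEsub
  have hδ0 : 0 < δ := hδ.1
  have hfin : IsFiniteMeasure (volume.restrict E) :=
    ⟨by simpa using (isBounded_extendedDomain hb δ).measure_lt_top⟩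
  have hutL : MemLp ut 2 (volume.restrict E) :=
    MemLp.of_bound ((hut.1.continuousOn.mono hEsub).aestronglyMeasurable hEm) M₀
      ((ae_restrict_iff' hEm).2 (Eventually.of_forall fun x hx => hM₀ x (hEsub hx)))
  have hG' : ∫⁻ z, ENNReal.ofReal (k z) ≤ ENNReal.ofReal (|CG| * δ⁻¹ ^ 2) := by
    refine ((hk.lintegral_le hγk hne).trans (hG δ hδ)).trans (ENNReal.ofReal_le_ofReal ?_)
    rw [zpow_neg, inv_pow]
    exact mul_le_mul_of_nonneg_right (le_abs_self CG) (by positivity)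
  have hsqG : √(|CG| * δ⁻¹ ^ 2) = √|CG| * δ⁻¹ := by
    rw [Real.sqrt_mul (abs_nonneg _), Real.sqrt_sq (by positivity)]
  have hdiffL : MemLp (u - ut) 2 (volume.restrict E) := hu.1.memLp.sub hutL
  have he := hdiffL.indicator hΩo.measurableSet
  have hr := hdiffL.indicator hc
  -- residual of the extended local solution
  have hres : ∀ x ∈ Ω, |f δ x + 2 * (∫ y in E, (ut y - ut x) * k (y - x))| ≤ A * δ ^ 2 := by
    intro x hx
    have h1 := hk.abs_integral_sub_laplacian_le hδ0 hopen hEsub hut.1 hM₄ hM₀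
      (ball_subset_extendedDomain hx)
    have hlap : Laplacian.laplacian ut x = -f₀ x := by
      rw [← hu₀.equation x hx, neg_neg]
      exact (InnerProductSpace.laplacian_congr_nhds
        (Filter.eventuallyEq_of_mem (hΩo.mem_nhds hx) hut_ext)).eq_of_nhds
    rw [hlap] at h1
    have h2 := hf δ hδ x hx
    have h3 : Cf * δ ^ 2 ≤ |Cf| * δ ^ 2 := by gcongr; exact le_abs_self _
    calc _ = |(f δ x - f₀ x) + (2 * (∫ y in E, (ut y - ut x) * k (y - x)) - -f₀ x)| := by
          congr 1; ring
      _ ≤ |f δ x - f₀ x| + |2 * (∫ y in E, (ut y - ut x) * k (y - x)) - -f₀ x| := abs_add_le _ _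
      _ ≤ |Cf| * δ ^ 2 + 2 * M₄ * d * δ ^ 2 := add_le_add (h2.trans h3) h1
      _ = A * δ ^ 2 := by rw [hA]; ring
  -- error in the interaction domain
  have hrb : eLpNorm ((interactionDomain Ω δ).indicator (u - ut)) 2 (volume.restrict E)
      ≤ ENNReal.ofReal (√(C₁ * δ) * (|Cg| * δ ^ (2 + μ))) := by
    rw [eLpNorm_indicator_eq_eLpNorm_restrict hc, Measure.restrict_restrict hc,
      inter_eq_self_of_subset_left interactionDomain_subset]
    refine eLpNorm_two_le_of_ae_bound ?_ ?_
    · rw [Measure.restrict_apply_univ]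
      exact hC₁ δ hδ
    · filter_upwards [hu.1.constraint, ae_restrict_mem hc] with x hx hxc
      rw [Pi.sub_apply, hx]
      refine (hg δ hδ x hxc).trans ?_
      gcongr
      exact le_abs_self _
  have hTr := norm_incrementLp_le hk.integrable hk.even (by positivity) hG' hr hrb
  have hTe := hu.norm_sub_le hd hδ0 hΩo hb hk hγk (hf_meas δ hδ) hutL (by positivity) hres hV
    hD0 hDΩ he hr
  set η := δ ^ ((3 + (μ : ℝ)) / 2) with hη
  have hη0 : 0 ≤ η := Real.rpow_nonneg hδ0.le _
  obtain ⟨hrate₁, hrate₂⟩ := rpow_rate_bounds hδ0 hδ.2 hμ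
  have hN : ‖incrementLp hk.integrable hk.even he‖ ≤ K₁ * η := by
    refine hTe.trans ((add_le_add_right hTr _).trans ?_)
    rw [hsqG, Real.sqrt_mul hC₁0]
    calc √V * (A * δ ^ 2) * (D + D + δ)
          + 2 * (√|CG| * δ⁻¹) * (√C₁ * √δ * (|Cg| * δ ^ (2 + μ)))
        = √V * A * (D + D + δ) * δ ^ 2
          + 2 * √|CG| * (√C₁ * |Cg|) * (√δ * (δ⁻¹ * δ ^ (2 + μ))) := by ring
      _ ≤ √V * A * (D + D + δ₀) * ((1 + δ₀) * η)
          + 2 * √|CG| * (√C₁ * |Cg|) * ((1 + δ₀) * η) := by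
        gcongr
        exact hδ.2
      _ = K₁ * η := by rw [hK₁]; ring
  -- interpolation
  have hKD : K.space ⊆ extendedDomain Ω δ₀ := by
    rw [hK.space_eq]
    exact closure_subset_extendedDomain hδ₀
  obtain ⟨p, hp, hpM⟩ := exists_interpolant hK.toIsMesh hopen hKD
    (hut.1.of_le (by norm_num)) hM₂
  have hpB : ∀ x ∈ Ω, |p x - ut x| ≤ B * h ^ 2 := fun x hx => by
    refine (hpM x (hK.space_eq ▸ subset_closure hx)).trans ?_
    gcongr
    exact le_add_of_nonneg_right (abs_nonneg _)
  have hgB : ∀ x ∈ interactionDomain Ω δ, |g δ x - gh x| ≤ B * h ^ 2 := fun x hx => by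
    refine (hggh x hx).trans ?_
    gcongr
    exact (le_abs_self _).trans (le_add_of_nonneg_left hM₂0)
  obtain ⟨h1, h2⟩ := cdg_error_le hu hd hδ0 hΩo hb hk hγk hutL (by positivity) hG' hV hD0 hDΩ he
    hK hKc hgh hp hpB hgB huh hN
  have hρ0 : 0 ≤ δ⁻¹ * h ^ 2 := by positivity
  have hK₂' : 2 * √(|CG| * δ⁻¹ ^ 2) * (√V * (B * h ^ 2)) = K₂ * (δ⁻¹ * h ^ 2) := by
    rw [hsqG, hK₂]; ring
  rw [hK₂'] at h1 h2
  set θ := δ⁻¹ * h ^ 2 with hθ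
  -- The direct L² contribution of q is O(h²), without the factor δ⁻¹; it is absorbed since δ ≤ δ₀.
  have hh2 : h ^ 2 ≤ δ₀ * θ := by
    calc h ^ 2 = δ * θ := by rw [hθ, mul_inv_cancel_left₀ hδ0.ne']
      _ ≤ δ₀ * θ := by gcongr; exact hδ.2
  set P := (D + D + δ₀) * (2 * K₁ + K₂) with hP
  have hP0 : 0 ≤ P := by positivity
  have hQ0 : 0 ≤ √V * B * δ₀ := by positivity
  refine ⟨h1.trans (ENNReal.ofReal_le_ofReal ?_), h2.trans (ENNReal.ofReal_le_ofReal ?_)⟩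
  · exact energy_rate_le hK₁0 hK₂0 (add_nonneg hP0 hQ0) hη0 hρ0
  · exact l2_rate_le hK₁0 hK₂0 hB0 hδ₀.le hδ.2 (add_nonneg hD0 hδ0.le) hη0 hρ0 hh2
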